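/- Equip $\mathbb{R}^7$ with its standard inner product and canonical basis $\mathbf e_1,\dots,\mathbf e_7$, and let $\times$ be the $7$-dimensional cross product, that is, the skew-symmetric bilinear map with $\mathbf e_i\times\mathbf e_j=\mathbf e_k$, $\mathbf e_j\times\mathbf e_k=\mathbf e_i$, $\mathbf e_k\times\mathbf e_i=\mathbf e_j$ for $(i,j,k)\in\{(1,2,3),(1,4,5),(1,7,6),(2,4,6),(2,5,7),(3,4,7),(3,6,5)\}$. Let $S^6\subset\mathbb{R}^7$ be the unit sphere, with the nearly Kähler structure $J\mathbf u=\mathbf x\times\mathbf u$ for $\mathbf x\in S^6$, $\mathbf u\in T_{\mathbf x}S^6$. An almost complex curve is a non-constant smooth map $\psi:\Sigma\to S^6$ from a Riemann surface whose differential is complex linear with respect to $J$; it is of type (III) if it is linearly full in some totally geodesic $S^5\subset S^6$, i.e. if the linear span of $\psi(\Sigma)$ has dimension $6$. For a unit vector $\mathbf v\in\mathbb{R}^7$ and $\beta\in\mathbb{R}$, let $R_{\mathbf v}(\beta)$ be the linear map of $\mathbb{R}^7$ with $R_{\mathbf v}(\beta)\mathbf v=\mathbf v$ and $R_{\mathbf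 v}(\beta)\mathbf x=\cos\beta\,\mathbf x+\sin\beta\,\mathbf v\times\mathbf x$ for $\mathbf x\in\mathbf v^\perp$. **Theorem.** Let $\Sigma$ be a (connected) Riemann surface, let $\varphi:\Sigma\to S^6$ be a conformal harmonic immersion, and let $F:\Sigma\to\mathbb{R}^7$ be a smooth map with $\mathrm dF=\varphi\times *\mathrm d\varphi$, which in a local conformal coordinate $z=x+iy$ means $F_x=\varphi\times\varphi_y$ and $F_y=-\varphi\times\varphi_x$. Then $F$ is a minimal immersion into some hypersphere of $\mathbb{R}^7$ (of arbitrary centre and positive radius) if and only if, for the given orientation of $\Sigma$ or for the opposite one (that is, for the given complex structure of $\Sigma$ or for the conjugate one), one of the following statements holds: 1. $\varphi$ is an almost complex curve; 2. there exist a unit vector $\mathbf v\in\mathbb{R}^7$, an angle $\beta\in\mathbb{R}$ and an almost complex curve $\tilde\varphi:\Sigma\to S^6$ of type (III), with $\tilde\varphi(\Sigma)\subset S^6\cap\mathbf v^\perp$, such that $\varphi=R_{\mathbf v}(\beta)\tilde\varphi$; 3. $\varphi$ is totally geodesic in $S^6$, i.e. its second fundamental form as an immersion into $S^6$ vanishes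 identically. -/

import Mathlib

open scoped Manifold ContDiff

/-- Euclidean seven-space. The basis vector `e₁` has index `0`, ..., `e₇` has index `6`. -/
abbrev E7 : Type := EuclideanSpace ℝ (Fin 7)

/-- The seven-dimensional cross product with
`e₁ × e₂ = e₃`, `e₁ × e₄ = e₅`, `e₁ × e₇ = e₆`, `e₂ × e₄ = e₆`, `e₂ × e₅ = e₇`,
`e₃ × e₄ = e₇`, `e₃ × e₆ = e₅` (and the cyclic permutations of these relations). -/
noncomputable def cross7 (x y : E7) : E7 :=
  !₂[x 1 * y 2 - x 2 * y 1 + (x 3 * y 4 - x 4 * y 3) + (x 6 * y 5 - x 5 * y 6),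
     x 2 * y 0 - x 0 * y 2 + (x 3 * y 5 - x 5 * y 3) + (x 4 * y 6 - x 6 * y 4),
     x 0 * y 1 - x 1 * y 0 + (x 3 * y 6 - x 6 * y 3) + (x 5 * y 4 - x 4 * y 5),
     x 4 * y 0 - x 0 * y 4 + (x 5 * y 1 - x 1 * y 5) + (x 6 * y 2 - x 2 * y 6),
     x 0 * y 3 - x 3 * y 0 + (x 6 * y 1 - x 1 * y 6) + (x 2 * y 5 - x 5 * y 2),
     x 1 * y 3 - x 3 * y 1 + (x 0 * y 6 - x 6 * y 0) + (x 4 * y 2 - x 2 * y 4),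
     x 5 * y 0 - x 0 * y 5 + (x 1 * y 4 - x 4 * y 1) + (x 2 * y 3 - x 3 * y 2)]

/-- The rotation `R_v(β)` of `ℝ⁷` (for a unit vector `v`): the linear map that fixes `v` and sends
`x` to `cos β x + sin β (v × x)` for `x` orthogonal to `v`. -/
noncomputable def rot7 (v : E7) (β : ℝ) (x : E7) : E7 :=
  inner ℝ v x • v + Real.cos β • (x - inner ℝ v x • v) + Real.sin β • cross7 v x

theorem rot7_self (v : E7) (hv : ‖v‖ = 1) (β : ℝ) : rot7 v β v = v := by
  have h : cross7 v v = 0 := by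
    ext i
    fin_cases i <;> simp [cross7] <;> ring
  simp [rot7, h, hv]

theorem rot7_of_orthogonal (v x : E7) (β : ℝ) (h : inner ℝ v x = 0) :
    rot7 v β x = Real.cos β • x + Real.sin β • cross7 v x := by
  simp [rot7, h]

section LocalGeometry

/-! In this section `g : ℂ → E7` is the expression of a map in a conformal coordinate
`z = x + i y`. The derivative in the real direction `a` is `fderiv ℝ g z a`, so that
`g_x = fderiv ℝ g z 1` and `g_y = fderiv ℝ g z Complex.I`. -/

/-- The second derivative `∂_a ∂_b g` at `z`. -/
noncomputable def secondDeriv (g : ℂ → E7) (z a b : ℂ) : E7 :=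
  fderiv ℝ (fun w => fderiv ℝ g w b) z a

/-- The second fundamental form, as an immersion into the hypersphere with centre `c`, of an
immersion `g` with values in that hypersphere: the component of `∂_a ∂_b g` normal to the surface
and tangent to the hypersphere. -/
noncomputable def sphereSecondFF (c : E7) (g : ℂ → E7) (z a b : ℂ) : E7 :=
  ((Submodule.span ℝ {g z - c, fderiv ℝ g z 1, fderiv ℝ g z Complex.I})ᗮ).starProjection
    (secondDeriv g z a b)

/-- The mean curvature vector `½ tr (I⁻¹ II)` of an immersion `g` into the hypersphere with
centre `c`, where `I` and `II` are the first and the second fundamental form. -/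
noncomputable def sphereMeanCurvature (c : E7) (g : ℂ → E7) (z : ℂ) : E7 :=
  let gx : E7 := fderiv ℝ g z 1
  let gy : E7 := fderiv ℝ g z Complex.I
  let I11 : ℝ := inner ℝ gx gx
  let I12 : ℝ := inner ℝ gx gy
  let I22 : ℝ := inner ℝ gy gy
  (1 / 2 * (I11 * I22 - I12 ^ 2)⁻¹) •
    (I22 • sphereSecondFF c g z 1 1 - (2 * I12) • sphereSecondFF c g z 1 Complex.I
      + I11 • sphereSecondFF c g z Complex.I Complex.I)

end LocalGeometry

section Surface

variable {S : Type*} [TopologicalSpace S] [ChartedSpace ℂ S]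

/-- A smooth map of the real surface underlying `S` to `ℝ⁷`. -/
def IsSmoothMap (f : S → E7) : Prop :=
  ContMDiff 𝓘(ℝ, ℂ) 𝓘(ℝ, E7) ∞ f

/-- An immersion: `f` is smooth and its differential is injective at every point. -/
def IsImmersedSurface (f : S → E7) : Prop :=
  IsSmoothMap f ∧
    ∀ e ∈ atlas ℂ S, ∀ z ∈ e.target, Function.Injective (fderiv ℝ (f ∘ e.symm) z)

/-- A conformal harmonic immersion of `S` into the unit sphere `S⁶ ⊆ ℝ⁷`. Harmonicity means that
`φ_xx + φ_yy` is orthogonal to the tangent space of `S⁶` at `φ`. -/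
structure IsConformalHarmonicImmersion (φ : S → E7) : Prop where
  mem_sphere : ∀ p, φ p ∈ Metric.sphere (0 : E7) 1
  immersion : IsImmersedSurface φ
  norm_eq : ∀ e ∈ atlas ℂ S, ∀ z ∈ e.target,
    ‖fderiv ℝ (φ ∘ e.symm) z 1‖ = ‖fderiv ℝ (φ ∘ e.symm) z Complex.I‖
  inner_eq_zero : ∀ e ∈ atlas ℂ S, ∀ z ∈ e.target,
    inner ℝ (fderiv ℝ (φ ∘ e.symm) z 1) (fderiv ℝ (φ ∘ e.symm) z Complex.I) = 0
  harmonic : ∀ e ∈ atlas ℂ S, ∀ z ∈ e.target, ∀ u : E7, inner ℝ (φ (e.symm z)) u = 0 →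
    inner ℝ (secondDeriv (φ ∘ e.symm) z 1 1
      + secondDeriv (φ ∘ e.symm) z Complex.I Complex.I) u = 0

/-- `dF = φ × *dφ`, where `(*ω)(v) = ω(i v)` for a one-form `ω`; in a conformal coordinate this
reads `F_x = φ × φ_y` and `F_y = - φ × φ_x`. -/
def IsAssociatedSurface (φ F : S → E7) : Prop :=
  IsSmoothMap F ∧ ∀ e ∈ atlas ℂ S, ∀ z ∈ e.target, ∀ v : ℂ,
    fderiv ℝ (F ∘ e.symm) z v =
      cross7 (φ (e.symm z)) (fderiv ℝ (φ ∘ e.symm) z (Complex.I * v))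

/-- `F` is an immersion with values in some hypersphere of `ℝ⁷`, and its mean curvature vector as
an immersion into that hypersphere vanishes. -/
def IsMinimalInSomeHypersphere (F : S → E7) : Prop :=
  IsImmersedSurface F ∧ ∃ (c : E7) (r : ℝ), 0 < r ∧ (∀ p, F p ∈ Metric.sphere c r) ∧
    ∀ e ∈ atlas ℂ S, ∀ z ∈ e.target, sphereMeanCurvature c (F ∘ e.symm) z = 0

/-- The second fundamental form of `φ`, as an immersion into the unit sphere, vanishes. -/
def IsTotallyGeodesicInSphere (φ : S → E7) : Prop :=
  ∀ e ∈ atlas ℂ S, ∀ z ∈ e.target, ∀ a b : ℂ, sphereSecondFF 0 (φ ∘ e.symm) z a b = 0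

variable (S) in
/-- The charts of `S` followed by complex conjugation: an atlas of the conjugate Riemann surface,
which is `S` with the opposite orientation. -/
noncomputable def conjAtlas : Set (OpenPartialHomeomorph S ℂ) :=
  (fun e => e.trans Complex.conjCLE.toHomeomorph.toOpenPartialHomeomorph) '' atlas ℂ S

/-- `φ` is an almost complex curve in `S⁶` with respect to the complex structure on `S` given by
the charts in `A`: a non-constant smooth map whose differential is complex linear for the nearly
Kähler structure `J u = x × u` (`u` tangent to `S⁶` at `x`). -/
structure IsAlmostComplexCurve (A : Set (OpenPartialHomeomorph S ℂ)) (φ : S → E7) : Prop where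
  mem_sphere : ∀ p, φ p ∈ Metric.sphere (0 : E7) 1
  smooth : IsSmoothMap φ
  nonconstant : ∃ p q, φ p ≠ φ q
  complex_linear : ∀ e ∈ A, ∀ z ∈ e.target, ∀ v : ℂ,
    fderiv ℝ (φ ∘ e.symm) z (Complex.I * v) =
      cross7 (φ (e.symm z)) (fderiv ℝ (φ ∘ e.symm) z v)

/-- An almost complex curve of type (III): it is linearly full in some totally geodesic
`S⁵ ⊆ S⁶`, that is, its image spans a six-dimensional linear subspace of `ℝ⁷`. -/
def IsAlmostComplexCurveTypeIII (A : Set (OpenPartialHomeomorph S ℂ)) (φ : S → E7) : Prop :=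
  IsAlmostComplexCurve A φ ∧ Module.finrank ℝ (Submodule.span ℝ (Set.range φ)) = 6

end Surface

open Filter Topology

/-! Let N be the cross product of an oriented orthonormal frame of the tangent plane of φ, so that
φ_x × φ_y = |φ_x|² N. In ΔF the mixed second derivatives of φ cancel, leaving ΔF = 2|φ_x|² N, which
is normal to F. Minimality in a sphere with centre c thus makes N a multiple of F - c, and comparing
⟨F - c, ΔF⟩ = -2|φ_x|² with |ΔF| forces radius 1 and N = c - F. So the property of F is equivalent
to dN = -dF (`IsMinimalInSomeHypersphere.exists_isNormalField`,
`IsNormalField.isMinimalInSomeHypersphere`).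

Since N × dφ = *dφ, this equation makes α = ⟨N, φ⟩ and φ × N constant (`IsNormalField.inner_eq`,
`IsNormalField.crossL_eq`). If α = ±1, then N = ±φ and φ is almost complex for one of the two
orientations. Otherwise let v be the unit vector along -φ × N; then N = R_v(-3β) φ with cos 3β = α.
By `crossL_rotL_rotL` the cross product is conjugate-linear in each factor for the complex structure
v × · on the vectors concerned, and this makes R_v(-β) φ almost complex. If φ spans the complement
of v, this is type (III). If a further direction u is orthogonal to φ, the constant vector v × u
lies in the span of φ, φ_x, φ_y at every point, and harmonicity then forces φ to be totally geodesic
(`sphereSecondFF_eq_zero_of_mem_span`).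

Conversely, dN = -dF holds with N = ±φ in the first case and N = ±R_v(-2β) φ' in the second; in the
third it follows by differentiating |φ_x|² N = φ_x × φ_y. -/

theorem inner_eq_sum7 (x y : E7) : inner ℝ x y = x 0 * y 0 + x 1 * y 1 + x 2 * y 2 + x 3 * y 3
    + x 4 * y 4 + x 5 * y 5 + x 6 * y 6 := by
  simp [PiLp.inner_apply, Fin.sum_univ_seven]
  ring

/-! ### Algebra of the cross product. -/

/-- The cross product as a continuous bilinear map. -/
noncomputable def crossL : E7 →L[ℝ] E7 →L[ℝ] E7 :=
  LinearMap.toContinuousLinearMap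
    ((LinearMap.toContinuousLinearMap (𝕜 := ℝ) (E := E7) (F' := E7)).toLinearMap ∘ₗ
      LinearMap.mk₂ ℝ cross7
        (fun x y z => by ext i; fin_cases i <;> simp [cross7] <;> ring)
        (fun c x y => by ext i; fin_cases i <;> simp [cross7] <;> ring)
        (fun x y z => by ext i; fin_cases i <;> simp [cross7] <;> ring)
        (fun c x y => by ext i; fin_cases i <;> simp [cross7] <;> ring))

theorem crossL_apply (x y : E7) : crossL x y = cross7 x y := rfl

theorem crossL_swap (x y : E7) : crossL x y = -crossL y x := by
  ext i; fin_cases i <;> simp [crossL_apply, cross7] <;> ring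

theorem crossL_self (x : E7) : crossL x x = 0 := by
  ext i; fin_cases i <;> simp [crossL_apply, cross7] <;> ring

theorem inner_crossL_left (x y z : E7) : inner ℝ (crossL x y) z = inner ℝ x (crossL y z) := by
  simp [inner_eq_sum7, crossL_apply, cross7]
  ring

theorem inner_crossL_self_left (x y : E7) : inner ℝ x (crossL x y) = 0 := by
  rw [← inner_crossL_left, crossL_self, inner_zero_left]

theorem inner_crossL_self_right (x y : E7) : inner ℝ y (crossL x y) = 0 := by
  rw [crossL_swap, inner_neg_right, inner_crossL_self_left, neg_zero]

theorem inner_crossL_swap (x y z : E7) : inner ℝ x (crossL y z) = -inner ℝ y (crossL x z) := by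
  rw [← inner_crossL_left, crossL_swap, inner_neg_left, inner_crossL_left]

theorem crossL_crossL_self (x y : E7) :
    crossL x (crossL x y) = inner ℝ x y • x - inner ℝ x x • y := by
  rw [inner_eq_sum7, inner_eq_sum7]
  ext i
  fin_cases i <;> simp [crossL_apply, cross7] <;> ring

/-- Polarisation of `crossL_crossL_self` in its first argument. -/
theorem crossL_crossL (x y z : E7) :
    crossL x (crossL y z) = -crossL y (crossL x z) + inner ℝ x z • y + inner ℝ y z • x
      - (2 * inner ℝ x y) • z := by
  have h := crossL_crossL_self (x + y) z
  simp only [map_add, add_apply, crossL_crossL_self, inner_add_left,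
    inner_add_right, add_smul, smul_add] at h
  rw [real_inner_comm x y] at h
  rw [two_mul, add_smul]
  linear_combination (norm := module) h

theorem inner_crossL_crossL (x y z : E7) :
    inner ℝ (crossL x y) (crossL x z) = inner ℝ x x * inner ℝ y z - inner ℝ x y * inner ℝ x z := by
  rw [crossL_swap x y, inner_neg_left, inner_crossL_left, crossL_crossL_self, inner_sub_right,
    inner_smul_right, inner_smul_right, real_inner_comm x y]
  ring

theorem norm_crossL_of_inner_eq_zero {x y : E7} (h : inner ℝ x y = 0) :
    ‖crossL x y‖ = ‖x‖ * ‖y‖ := by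
  have h2 : ‖crossL x y‖ ^ 2 = (‖x‖ * ‖y‖) ^ 2 := by
    rw [← real_inner_self_eq_norm_sq, inner_crossL_crossL, h, real_inner_self_eq_norm_sq,
      real_inner_self_eq_norm_sq]
    ring
  exact (pow_left_inj₀ (norm_nonneg _) (by positivity) two_ne_zero).1 h2

/-! ### Rotations about v. -/

/-- `rot7 v β` as a continuous linear map. -/
noncomputable def rotL (v : E7) (β : ℝ) : E7 →L[ℝ] E7 :=
  (innerSL ℝ v).smulRight v
    + Real.cos β • (ContinuousLinearMap.id ℝ E7 - (innerSL ℝ v).smulRight v)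
    + Real.sin β • crossL v

theorem rotL_apply (v : E7) (β : ℝ) (x : E7) : rotL v β x = rot7 v β x := by
  simp [rotL, rot7, crossL_apply]

theorem rotL_of_orthogonal {v x : E7} (β : ℝ) (h : inner ℝ v x = 0) :
    rotL v β x = Real.cos β • x + Real.sin β • crossL v x := by
  rw [rotL_apply, rot7_of_orthogonal v x β h, crossL_apply]

theorem inner_rotL_right {v x : E7} (β : ℝ) (h : inner ℝ v x = 0) :
    inner ℝ v (rotL v β x) = 0 := by
  rw [rotL_of_orthogonal β h, inner_add_right, inner_smul_right, inner_smul_right,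
    inner_crossL_self_left, h]
  ring

theorem rotL_rotL {v x : E7} (hv : ‖v‖ = 1) (β γ : ℝ) (h : inner ℝ v x = 0) :
    rotL v β (rotL v γ x) = rotL v (β + γ) x := by
  rw [rotL_of_orthogonal β (inner_rotL_right γ h), rotL_of_orthogonal γ h, rotL_of_orthogonal _ h]
  simp only [map_add, map_smul, crossL_crossL_self, h, real_inner_self_eq_norm_sq, hv,
    Real.cos_add, Real.sin_add]
  module

theorem rotL_zero {v x : E7} (h : inner ℝ v x = 0) : rotL v 0 x = x := by
  simp [rotL_of_orthogonal 0 h]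

theorem inner_rotL_rotL {v x y : E7} (hv : ‖v‖ = 1) (β : ℝ) (hx : inner ℝ v x = 0)
    (hy : inner ℝ v y = 0) : inner ℝ (rotL v β x) (rotL v β y) = inner ℝ x y := by
  have e1 : inner ℝ (crossL v x) y = -inner ℝ x (crossL v y) := by
    rw [inner_crossL_left, inner_crossL_swap]
  rw [rotL_of_orthogonal β hx, rotL_of_orthogonal β hy]
  simp only [inner_add_left, inner_add_right, inner_smul_left, inner_smul_right,
    inner_crossL_crossL, e1, hx, hy, real_inner_self_eq_norm_sq, hv, conj_trivial]
  linear_combination inner ℝ x y * Real.sin_sq_add_cos_sq β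

theorem norm_rotL {v x : E7} (hv : ‖v‖ = 1) (β : ℝ) (hx : inner ℝ v x = 0) :
    ‖rotL v β x‖ = ‖x‖ := by
  rw [norm_eq_sqrt_real_inner, norm_eq_sqrt_real_inner, inner_rotL_rotL hv β hx hx]

/-- On the complement of v, v × · is a complex structure and R_v(β) is multiplication by exp(iβ).
For orthogonal a, b with a × b also orthogonal to v, v × · anticommutes past the cross product in
either factor, so the product is conjugate-linear in both and the angle becomes -(β + γ). -/
theorem crossL_rotL_rotL {v a b : E7} (hv : ‖v‖ = 1) (β γ : ℝ) (ha : inner ℝ v a = 0)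
    (hb : inner ℝ v b = 0) (hab : inner ℝ a b = 0) (hvab : inner ℝ v (crossL a b) = 0) :
    crossL (rotL v β a) (rotL v γ b) = rotL v (-(β + γ)) (crossL a b) := by
  have e1 : crossL a (crossL v b) = -crossL v (crossL a b) := by
    rw [crossL_crossL, hab, hb, real_inner_comm, ha]; module
  have e2 : crossL (crossL v a) b = -crossL v (crossL a b) := by
    rw [crossL_swap, crossL_crossL, crossL_swap b a, real_inner_comm, hab, ha, real_inner_comm, hb,
      map_neg]
    module
  have e3 : crossL (crossL v a) (crossL v b) = -crossL a b := by
    have h0 : inner ℝ b (crossL v a) = 0 := by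
      rw [inner_crossL_swap, crossL_swap, inner_neg_right, hvab]; simp
    rw [crossL_crossL, e2, real_inner_comm, h0, real_inner_comm v, inner_crossL_self_left, map_neg,
      crossL_crossL_self, hvab, real_inner_self_eq_norm_sq, hv, hb]
    module
  rw [rotL_of_orthogonal β ha, rotL_of_orthogonal γ hb, rotL_of_orthogonal _ hvab]
  simp only [map_add, map_smul, add_apply, smul_apply,
    e1, e2, e3, Real.cos_neg, Real.sin_neg, Real.cos_add, Real.sin_add]
  module

/-- If `a`, `b`, `c`, `v` are orthogonal and nonzero and `v` is orthogonal to the cross products of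
`a`, `b`, `c`, then `a`, `b`, `c`, `v`, `v × a`, `v × b`, `v × c` span `ℝ⁷`. -/
theorem eq_zero_of_orthogonal_frame {v a b c x : E7} (hv : v ≠ 0) (ha : a ≠ 0) (hb : b ≠ 0)
    (hc : c ≠ 0) (hva : inner ℝ v a = 0) (hvb : inner ℝ v b = 0) (hvc : inner ℝ v c = 0)
    (hab : inner ℝ a b = 0) (hac : inner ℝ a c = 0) (hbc : inner ℝ b c = 0)
    (hvab : inner ℝ v (crossL a b) = 0) (hvac : inner ℝ v (crossL a c) = 0)
    (hvbc : inner ℝ v (crossL b c) = 0)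
    (xv : inner ℝ x v = 0) (xa : inner ℝ x a = 0) (xb : inner ℝ x b = 0) (xc : inner ℝ x c = 0)
    (xva : inner ℝ x (crossL v a) = 0) (xvb : inner ℝ x (crossL v b) = 0)
    (xvc : inner ℝ x (crossL v c) = 0) : x = 0 := by
  have key : ∀ {a b : E7}, inner ℝ v (crossL a b) = 0 → inner ℝ a (crossL v b) = 0 ∧
      inner ℝ b (crossL v a) = 0 := by
    intro a b h
    constructor
    · rw [inner_crossL_swap, h, neg_zero]
    · rw [inner_crossL_swap, crossL_swap, inner_neg_right, h]; simp
  have ne : ∀ {a : E7}, a ≠ 0 → inner ℝ v a = 0 → crossL v a ≠ 0 := by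
    intro a ha h
    rw [← norm_ne_zero_iff, norm_crossL_of_inner_eq_zero h]
    exact mul_ne_zero (norm_ne_zero_iff.2 hv) (norm_ne_zero_iff.2 ha)
  let f : Fin 7 → E7 := ![a, b, c, v, crossL v a, crossL v b, crossL v c]
  have hf0 : ∀ i, f i ≠ 0 := by
    intro i
    fin_cases i <;> simp [f, ha, hb, hc, hv, ne ha hva, ne hb hvb, ne hc hvc]
  have hlt : ∀ i j, i < j → inner ℝ (f i) (f j) = 0 := by
    intro i j hij
    fin_cases i <;> fin_cases j <;> first
      | (exact absurd hij (by decide))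
      | simp [f, hab, hac, hbc, real_inner_comm v, hva, hvb, hvc, inner_crossL_self_right,
          key hvab, key hvac, key hvbc, inner_crossL_crossL, inner_crossL_self_left]
  have hf : Pairwise fun i j => inner ℝ (f i) (f j) = 0 := by
    intro i j hij
    rcases lt_or_gt_of_ne hij with h | h
    · exact hlt i j h
    · rw [real_inner_comm]; exact hlt j i h
  have hli := linearIndependent_of_ne_zero_of_inner_eq_zero hf0 hf
  have hsp := hli.span_eq_top_of_card_eq_finrank (by simp)
  have hx : x ∈ (Submodule.span ℝ (Set.range f))ᗮ := by
    rw [Submodule.mem_orthogonal']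
    intro u hu
    refine Submodule.span_induction ?_ (by simp) ?_ ?_ hu
    · rintro _ ⟨i, rfl⟩
      fin_cases i <;> simp [f, xa, xb, xc, xv, xva, xvb, xvc]
    · intro y z _ _ hy hz; rw [inner_add_right, hy, hz, add_zero]
    · intro r y _ hy; rw [inner_smul_right, hy, mul_zero]
  rw [hsp, Submodule.top_orthogonal_eq_bot] at hx
  simpa using hx

theorem clm_complex_apply {E : Type*} [NormedAddCommGroup E] [NormedSpace ℝ E] (L : ℂ →L[ℝ] E)
    (w : ℂ) : L w = w.re • L 1 + w.im • L Complex.I := by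
  rw [← map_smul, ← map_smul, ← map_add]
  congr 1
  apply Complex.ext <;> simp

theorem starProjection_orthogonal_eq_zero_iff (K : Submodule ℝ E7) (x : E7) :
    Kᗮ.starProjection x = 0 ↔ x ∈ K := by
  rw [Submodule.starProjection_apply_eq_zero_iff, Submodule.orthogonal_orthogonal]

/-- Product rule for an inner product that is locally constant. -/
theorem inner_hasFDerivAt_eq_zero {f g : ℂ → E7} {f' g' : ℂ →L[ℝ] E7} {z : ℂ} {k : ℝ}
    (hf : HasFDerivAt f f' z) (hg : HasFDerivAt g g' z)
    (h : ∀ᶠ w in 𝓝 z, inner ℝ (f w) (g w) = k) (v : ℂ) :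
    inner ℝ (f z) (g' v) + inner ℝ (f' v) (g z) = 0 := by
  have h1 := hf.inner ℝ hg
  have h2 : HasFDerivAt (fun w => inner ℝ (f w) (g w)) (0 : ℂ →L[ℝ] ℝ) z :=
    (hasFDerivAt_const k z).congr_of_eventuallyEq h
  simpa using DFunLike.congr_fun (h1.unique h2) v

/-! ### The normal vector N of a conformal frame. -/

section Pointwise

variable {L : ℂ →L[ℝ] E7} {N : E7}

theorem norm_normal_eq_one (hne : L 1 ≠ 0) (hnorm : ‖L 1‖ = ‖L Complex.I‖)
    (horth : inner ℝ (L 1) (L Complex.I) = 0)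
    (hN : crossL (L 1) (L Complex.I) = ‖L 1‖ ^ 2 • N) : ‖N‖ = 1 := by
  have h := norm_crossL_of_inner_eq_zero horth
  have hpos : 0 < ‖L 1‖ := norm_pos_iff.2 hne
  rw [hN, norm_smul, ← hnorm, norm_pow, norm_norm, ← pow_two] at h
  exact mul_left_cancel₀ (pow_pos hpos 2).ne' (by rw [h, mul_one])

theorem inner_normal_apply (hne : L 1 ≠ 0)
    (hN : crossL (L 1) (L Complex.I) = ‖L 1‖ ^ 2 • N) (w : ℂ) : inner ℝ N (L w) = 0 := by
  have hpos : 0 < ‖L 1‖ := norm_pos_iff.2 hne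
  have h : ‖L 1‖ ^ 2 * inner ℝ N (L w) = 0 := by
    rw [← real_inner_smul_left, ← hN, clm_complex_apply L w, inner_add_right, inner_smul_right,
      inner_smul_right, real_inner_comm, inner_crossL_self_left, real_inner_comm,
      inner_crossL_self_right]
    simp
  exact (mul_eq_zero.1 h).resolve_left (pow_pos hpos 2).ne'

/-- For an orthonormal frame a, b the double cross product formula gives (a × b) × a = b and (a × b)
× b = -a, so N × · is the quarter turn of the tangent plane. -/
theorem crossL_normal_apply (hne : L 1 ≠ 0) (hnorm : ‖L 1‖ = ‖L Complex.I‖)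
    (horth : inner ℝ (L 1) (L Complex.I) = 0)
    (hN : crossL (L 1) (L Complex.I) = ‖L 1‖ ^ 2 • N) (w : ℂ) :
    crossL N (L w) = L (Complex.I * w) := by
  have hpos : ‖L 1‖ ^ 2 ≠ 0 := (pow_pos (norm_pos_iff.2 hne) 2).ne'
  have h1 : crossL N (L 1) = L Complex.I := by
    apply smul_right_injective E7 hpos
    simp only
    rw [← smul_apply, ← map_smul, ← hN, crossL_swap, crossL_crossL_self, horth,
      real_inner_self_eq_norm_sq]
    module
  have h2 : crossL N (L Complex.I) = -L 1 := by
    apply smul_right_injective E7 hpos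
    simp only
    rw [← smul_apply, ← map_smul, ← hN, crossL_swap (L 1), map_neg, neg_apply, crossL_swap,
      crossL_crossL_self, real_inner_comm, horth, real_inner_self_eq_norm_sq, hnorm]
    module
  rw [clm_complex_apply L w, clm_complex_apply L (Complex.I * w), map_add, map_smul, map_smul,
    h1, h2]
  simp only [Complex.mul_re, Complex.mul_im, Complex.I_re, Complex.I_im]
  module

end Pointwise

/-- The expression `g` of a conformal harmonic immersion into `S⁶` in a conformal coordinate. -/
structure IsConformalHarmonicOn (g : ℂ → E7) (U : Set ℂ) : Prop where
  isOpen : IsOpen U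
  contDiffOn : ContDiffOn ℝ ∞ g U
  norm_eq_one : ∀ z ∈ U, ‖g z‖ = 1
  ne_zero : ∀ z ∈ U, fderiv ℝ g z 1 ≠ 0
  norm_eq : ∀ z ∈ U, ‖fderiv ℝ g z 1‖ = ‖fderiv ℝ g z Complex.I‖
  inner_eq_zero : ∀ z ∈ U, inner ℝ (fderiv ℝ g z 1) (fderiv ℝ g z Complex.I) = 0
  harmonic : ∀ z ∈ U, ∀ u : E7, inner ℝ (g z) u = 0 →
    inner ℝ (secondDeriv g z 1 1 + secondDeriv g z Complex.I Complex.I) u = 0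

/-! ### Differential calculus in a coordinate. -/

section Derivatives

variable {g : ℂ → E7} {U : Set ℂ} {z : ℂ}

theorem ContDiffOn.hasFDerivAt_of_isOpen (hg : ContDiffOn ℝ ∞ g U) (hU : IsOpen U) (hz : z ∈ U) :
    HasFDerivAt g (fderiv ℝ g z) z :=
  ((hg.contDiffAt (hU.mem_nhds hz)).differentiableAt (by simp)).hasFDerivAt

theorem ContDiffOn.fderiv_apply_of_isOpen (hg : ContDiffOn ℝ ∞ g U) (hU : IsOpen U) (b : ℂ) :
    ContDiffOn ℝ ∞ (fun w => fderiv ℝ g w b) U :=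
  (hg.fderiv_of_isOpen hU (by simp)).clm_apply contDiffOn_const

theorem ContDiffOn.hasFDerivAt_fderiv_apply (hg : ContDiffOn ℝ ∞ g U) (hU : IsOpen U) (hz : z ∈ U)
    (b : ℂ) :
    HasFDerivAt (fun w => fderiv ℝ g w b) (fderiv ℝ (fun w => fderiv ℝ g w b) z) z :=
  (hg.fderiv_apply_of_isOpen hU b).hasFDerivAt_of_isOpen hU hz

theorem ContDiffOn.secondDeriv_eq (hg : ContDiffOn ℝ ∞ g U) (hU : IsOpen U) (hz : z ∈ U)
    (a b : ℂ) : secondDeriv g z a b = fderiv ℝ (fderiv ℝ g) z a b := by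
  have h : DifferentiableAt ℝ (fderiv ℝ g) z :=
    ((hg.fderiv_of_isOpen (m := ∞) hU (by simp)).contDiffAt (hU.mem_nhds hz)).differentiableAt
      (by simp)
  have := (h.hasFDerivAt.clm_apply (hasFDerivAt_const b z)).fderiv
  simp [secondDeriv, this]

theorem ContDiffOn.secondDeriv_symm (hg : ContDiffOn ℝ ∞ g U) (hU : IsOpen U) (hz : z ∈ U)
    (a b : ℂ) : secondDeriv g z a b = secondDeriv g z b a := by
  rw [hg.secondDeriv_eq hU hz, hg.secondDeriv_eq hU hz]
  exact (hg.contDiffAt (hU.mem_nhds hz)).isSymmSndFDerivAt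
    (by simpa using (WithTop.coe_le_coe.2 (le_top : (2 : ℕ∞) ≤ ⊤))) a b

theorem ContDiffOn.continuousAt_secondDeriv (hg : ContDiffOn ℝ ∞ g U) (hU : IsOpen U) (hz : z ∈ U)
    (a b : ℂ) : ContinuousAt (fun w => secondDeriv g w a b) z :=
  ((hg.fderiv_apply_of_isOpen hU b).fderiv_apply_of_isOpen hU a).continuousOn.continuousAt
    (hU.mem_nhds hz)

theorem inner_fderiv_eq_zero_of_norm_eq {c : E7} {r : ℝ} (hg : ContDiffOn ℝ ∞ g U) (hU : IsOpen U)
    (hz : z ∈ U) (h : ∀ w ∈ U, ‖g w - c‖ = r) (v : ℂ) :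
    inner ℝ (g z - c) (fderiv ℝ g z v) = 0 := by
  have hd := (hg.hasFDerivAt_of_isOpen hU hz).sub_const c
  have := inner_hasFDerivAt_eq_zero (k := r ^ 2) hd hd
    (by filter_upwards [hU.mem_nhds hz] with w hw; rw [real_inner_self_eq_norm_sq, h w hw]) v
  rw [real_inner_comm (g z - c)] at this
  linarith

/-- Differentiate ⟨g - c, ∂_b g⟩ = 0 in the direction a. -/
theorem inner_secondDeriv_of_norm_eq {c : E7} {r : ℝ} (hg : ContDiffOn ℝ ∞ g U) (hU : IsOpen U)
    (hz : z ∈ U) (h : ∀ w ∈ U, ‖g w - c‖ = r) (a b : ℂ) :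
    inner ℝ (g z - c) (secondDeriv g z a b) = -inner ℝ (fderiv ℝ g z a) (fderiv ℝ g z b) := by
  have hd := (hg.hasFDerivAt_of_isOpen hU hz).sub_const c
  have := inner_hasFDerivAt_eq_zero (k := 0) hd (hg.hasFDerivAt_fderiv_apply hU hz b)
    (by filter_upwards [hU.mem_nhds hz] with w hw
        exact inner_fderiv_eq_zero_of_norm_eq hg hU hw h b) a
  unfold secondDeriv
  linarith

end Derivatives

namespace IsConformalHarmonicOn

variable {g : ℂ → E7} {U : Set ℂ} {z : ℂ}

theorem inner_fderiv (hg : IsConformalHarmonicOn g U) (hz : z ∈ U) (v : ℂ) :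
    inner ℝ (g z) (fderiv ℝ g z v) = 0 := by
  simpa using inner_fderiv_eq_zero_of_norm_eq (c := 0) (r := 1) hg.contDiffOn hg.isOpen hz
    (by simpa using hg.norm_eq_one) v

theorem inner_secondDeriv (hg : IsConformalHarmonicOn g U) (hz : z ∈ U) (a b : ℂ) :
    inner ℝ (g z) (secondDeriv g z a b) = -inner ℝ (fderiv ℝ g z a) (fderiv ℝ g z b) := by
  simpa using inner_secondDeriv_of_norm_eq (c := 0) (r := 1) hg.contDiffOn hg.isOpen hz
    (by simpa using hg.norm_eq_one) a b

end IsConformalHarmonicOn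

/-! ### Mean curvature of the associated surface. -/

namespace IsConformalHarmonicOn

variable {g F : ℂ → E7} {U : Set ℂ} {z : ℂ}

theorem secondDeriv_associated (hg : IsConformalHarmonicOn g U)
    (hF : ∀ w ∈ U, ∀ v : ℂ, fderiv ℝ F w v = crossL (g w) (fderiv ℝ g w (Complex.I * v)))
    (hz : z ∈ U) (a b : ℂ) :
    secondDeriv F z a b = crossL (fderiv ℝ g z a) (fderiv ℝ g z (Complex.I * b))
      + crossL (g z) (secondDeriv g z a (Complex.I * b)) := by
  have h1 : (fun w => fderiv ℝ F w b) =ᶠ[𝓝 z]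
      fun w => crossL (g w) (fderiv ℝ g w (Complex.I * b)) := by
    filter_upwards [hg.isOpen.mem_nhds hz] with w hw using hF w hw b
  have h2 := crossL.hasFDerivAt_of_bilinear (hg.contDiffOn.hasFDerivAt_of_isOpen hg.isOpen hz)
    (hg.contDiffOn.hasFDerivAt_fderiv_apply hg.isOpen hz (Complex.I * b))
  unfold secondDeriv
  rw [h1.fderiv_eq, h2.fderiv]
  simp [add_comm]

/-- F_xx contributes g × g_xy and F_yy contributes -g × g_yx, which cancel by symmetry; the two
remaining terms are equal. -/
theorem laplacian_associated (hg : IsConformalHarmonicOn g U)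
    (hF : ∀ w ∈ U, ∀ v : ℂ, fderiv ℝ F w v = crossL (g w) (fderiv ℝ g w (Complex.I * v)))
    (hz : z ∈ U) :
    secondDeriv F z 1 1 + secondDeriv F z Complex.I Complex.I
      = (2 : ℝ) • crossL (fderiv ℝ g z 1) (fderiv ℝ g z Complex.I) := by
  have h : fderiv ℝ (fun w => fderiv ℝ g w (Complex.I * Complex.I)) z Complex.I =
      -secondDeriv g z 1 Complex.I := by
    rw [hg.contDiffOn.secondDeriv_symm hg.isOpen hz]
    simp only [Complex.I_mul_I, map_neg]
    rw [fderiv_fun_neg, neg_apply]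
    rfl
  rw [hg.secondDeriv_associated hF hz, hg.secondDeriv_associated hF hz]
  rw [secondDeriv.eq_1 g z Complex.I, h, Complex.I_mul_I, map_neg, map_neg, map_neg, mul_one,
    crossL_swap (fderiv ℝ g z Complex.I)]
  module

/-- The map g × · is an isometry on the complement of the unit vector g, so F inherits the conformal
metric of g. -/
theorem inner_fderiv_associated (hg : IsConformalHarmonicOn g U)
    (hF : ∀ w ∈ U, ∀ v : ℂ, fderiv ℝ F w v = crossL (g w) (fderiv ℝ g w (Complex.I * v)))
    (hz : z ∈ U) (a b : ℂ) : inner ℝ (fderiv ℝ F z a) (fderiv ℝ F z b) =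
      inner ℝ (fderiv ℝ g z (Complex.I * a)) (fderiv ℝ g z (Complex.I * b)) := by
  rw [hF z hz, hF z hz, inner_crossL_crossL, real_inner_self_eq_norm_sq, hg.norm_eq_one z hz,
    hg.inner_fderiv hz]
  ring

/-- The mean curvature of the associated surface vanishes exactly if its Laplacian
has no component normal to the surface and tangent to the sphere. -/
theorem sphereMeanCurvature_associated_eq_zero_iff (hg : IsConformalHarmonicOn g U)
    (hF : ∀ w ∈ U, ∀ v : ℂ, fderiv ℝ F w v = crossL (g w) (fderiv ℝ g w (Complex.I * v)))
    (hz : z ∈ U) (c : E7) :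
    sphereMeanCurvature c F z = 0 ↔
      crossL (fderiv ℝ g z 1) (fderiv ℝ g z Complex.I) ∈
        Submodule.span ℝ {F z - c, fderiv ℝ F z 1, fderiv ℝ F z Complex.I} := by
  have hpos : 0 < ‖fderiv ℝ g z 1‖ := norm_pos_iff.2 (hg.ne_zero z hz)
  have h11 : inner ℝ (fderiv ℝ F z 1) (fderiv ℝ F z 1) = ‖fderiv ℝ g z 1‖ ^ 2 := by
    rw [hg.inner_fderiv_associated hF hz, mul_one, real_inner_self_eq_norm_sq, hg.norm_eq z hz]
  have h22 : inner ℝ (fderiv ℝ F z Complex.I) (fderiv ℝ F z Complex.I)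
      = ‖fderiv ℝ g z 1‖ ^ 2 := by
    rw [hg.inner_fderiv_associated hF hz, Complex.I_mul_I, map_neg, inner_neg_neg,
      real_inner_self_eq_norm_sq]
  have h12 : inner ℝ (fderiv ℝ F z 1) (fderiv ℝ F z Complex.I) = 0 := by
    rw [hg.inner_fderiv_associated hF hz, Complex.I_mul_I, map_neg, mul_one, inner_neg_right,
      real_inner_comm, hg.inner_eq_zero z hz, neg_zero]
  set l := ‖fderiv ℝ g z 1‖ ^ 2 with hl
  have hl0 : l ≠ 0 := (pow_pos hpos 2).ne'
  -- Conformality removes the mixed term and equates I11 with I22, so only the projected Laplacian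
  -- remains.
  have key : sphereMeanCurvature c F z = l⁻¹ •
      ((Submodule.span ℝ {F z - c, fderiv ℝ F z 1, fderiv ℝ F z Complex.I})ᗮ).starProjection
        (crossL (fderiv ℝ g z 1) (fderiv ℝ g z Complex.I)) := by
    have h3 := congrArg ((Submodule.span ℝ
      {F z - c, fderiv ℝ F z 1, fderiv ℝ F z Complex.I})ᗮ).starProjection
        (hg.laplacian_associated hF hz)
    rw [map_add, map_smul] at h3
    simp only [sphereMeanCurvature, h11, h22, h12, mul_zero, zero_smul, sub_zero, ← smul_add]
    simp only [sphereSecondFF, h3, smul_smul]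
    congr 1
    field_simp
    simp
  rw [key, smul_eq_zero_iff_right (inv_ne_zero hl0), starProjection_orthogonal_eq_zero_iff]

/-- If the associated surface is minimal in a hypersphere, then the position vector from the
centre is minus the cross product of an oriented orthonormal tangent frame of `g`. -/
theorem crossL_eq_of_minimal (hg : IsConformalHarmonicOn g U) (hFs : ContDiffOn ℝ ∞ F U)
    (hF : ∀ w ∈ U, ∀ v : ℂ, fderiv ℝ F w v = crossL (g w) (fderiv ℝ g w (Complex.I * v)))
    {c : E7} {r : ℝ} (hr : 0 < r) (hc : ∀ w ∈ U, ‖F w - c‖ = r) (hz : z ∈ U)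
    (hH : sphereMeanCurvature c F z = 0) :
    crossL (fderiv ℝ g z 1) (fderiv ℝ g z Complex.I) = ‖fderiv ℝ g z 1‖ ^ 2 • (c - F z) := by
  have hpos : 0 < ‖fderiv ℝ g z 1‖ := norm_pos_iff.2 (hg.ne_zero z hz)
  rw [hg.sphereMeanCurvature_associated_eq_zero_iff hF hz, Submodule.mem_span_triple] at hH
  obtain ⟨p, q, s, h⟩ := hH
  set X := crossL (fderiv ℝ g z 1) (fderiv ℝ g z Complex.I) with hX
  have hXF : ∀ v, inner ℝ X (fderiv ℝ F z v) = 0 := by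
    have h0 : ∀ v, inner ℝ (fderiv ℝ g z v) (g z) = 0 := fun v => by
      rw [real_inner_comm, hg.inner_fderiv hz]
    intro v
    rw [hF z hz, clm_complex_apply (fderiv ℝ g z) (Complex.I * v), map_add, map_smul, map_smul,
      inner_add_right, inner_smul_right, inner_smul_right, hX, crossL_swap (g z),
      inner_neg_right, inner_crossL_crossL, h0, h0,
      crossL_swap (fderiv ℝ g z 1), crossL_swap (g z) (fderiv ℝ g z Complex.I), inner_neg_neg,
      inner_crossL_crossL, h0, h0]
    simp
  have hcF : ∀ v, inner ℝ (F z - c) (fderiv ℝ F z v) = 0 := fun v =>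
    inner_fderiv_eq_zero_of_norm_eq hFs hg.isOpen hz hc v
  have hXX : X = p • (F z - c) := by
    have h1 : inner ℝ (X - p • (F z - c)) (X - p • (F z - c)) = 0 := by
      have h2 : X - p • (F z - c) = q • fderiv ℝ F z 1 + s • fderiv ℝ F z Complex.I := by
        rw [← h]; module
      nth_rw 2 [h2]
      simp only [inner_sub_left, inner_add_right, inner_smul_right, real_inner_smul_left, hXF, hcF]
      simp
    rwa [inner_self_eq_zero, sub_eq_zero] at h1
  -- The factor p is measured twice: through ⟨F - c, ΔF⟩ here, and through the norm of X in `hn`.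
  -- Together they give p < 0 and r = 1.
  have hp : p * r ^ 2 = -‖fderiv ℝ g z 1‖ ^ 2 := by
    have h1 : inner ℝ (F z - c) (secondDeriv F z 1 1 + secondDeriv F z Complex.I Complex.I)
        = -2 * ‖fderiv ℝ g z 1‖ ^ 2 := by
      rw [inner_add_right, inner_secondDeriv_of_norm_eq hFs hg.isOpen hz hc,
        inner_secondDeriv_of_norm_eq hFs hg.isOpen hz hc, hg.inner_fderiv_associated hF hz,
        hg.inner_fderiv_associated hF hz, Complex.I_mul_I, map_neg, inner_neg_neg, mul_one,
        real_inner_self_eq_norm_sq, real_inner_self_eq_norm_sq, hg.norm_eq z hz]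
      ring
    rw [hg.laplacian_associated hF hz, ← hX, hXX, inner_smul_right, inner_smul_right,
      real_inner_self_eq_norm_sq, hc z hz] at h1
    linarith
  have hn : |p| * r = ‖fderiv ℝ g z 1‖ ^ 2 := by
    have h1 := norm_crossL_of_inner_eq_zero (hg.inner_eq_zero z hz)
    rw [← hX, hXX, norm_smul, hc z hz, Real.norm_eq_abs, ← hg.norm_eq z hz] at h1
    rw [h1, pow_two]
  have hp0 : p < 0 := by
    have : p * r ^ 2 < 0 := by rw [hp]; exact neg_lt_zero.2 (pow_pos hpos 2)
    exact (neg_iff_pos_of_mul_neg this).2 (pow_pos hr 2)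
  rw [abs_of_neg hp0] at hn
  have hr1 : r = 1 := by
    have h1 : p * r * (r - 1) = 0 := by linear_combination hp + hn
    rcases mul_eq_zero.1 h1 with h2 | h2
    · exact absurd h2 (mul_neg_of_neg_of_pos hp0 hr).ne
    · linarith
  rw [hXX, ← hn, hr1]
  module

end IsConformalHarmonicOn

/-! ### The normal of a totally geodesic surface. -/

namespace IsConformalHarmonicOn

variable {g F : ℂ → E7} {U : Set ℂ} {z : ℂ}

/-- If the second fundamental form of `g` vanishes, then the cross product `N` of an oriented
orthonormal tangent frame satisfies `dN = -dF`. -/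
theorem hasFDerivAt_normal_of_totallyGeodesic (hg : IsConformalHarmonicOn g U)
    (hF : ∀ w ∈ U, ∀ v : ℂ, fderiv ℝ F w v = crossL (g w) (fderiv ℝ g w (Complex.I * v)))
    (hz : z ∈ U) (hII : ∀ a b, sphereSecondFF 0 g z a b = 0) {N : ℂ → E7}
    (hN : ∀ w ∈ U, crossL (fderiv ℝ g w 1) (fderiv ℝ g w Complex.I)
      = ‖fderiv ℝ g w 1‖ ^ 2 • N w) :
    HasFDerivAt N (-fderiv ℝ F z) z := by
  have hdx := hg.contDiffOn.hasFDerivAt_fderiv_apply hg.isOpen hz 1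
  have hdy := hg.contDiffOn.hasFDerivAt_fderiv_apply hg.isOpen hz Complex.I
  have hne := hg.ne_zero z hz
  have hl0 : ‖fderiv ℝ g z 1‖ ^ 2 ≠ 0 := (pow_pos (norm_pos_iff.2 hne) 2).ne'
  have hlam := hdx.inner ℝ hdx
  have hcr := crossL.hasFDerivAt_of_bilinear hdx hdy
  -- The hypothesis only gives N up to the factor |g_x|², so smoothness of N is obtained by division
  -- before the product rule is applied.
  have hdiff : DifferentiableAt ℝ N z := by
    have h1 : DifferentiableAt ℝ (fun w => (inner ℝ (fderiv ℝ g w 1) (fderiv ℝ g w 1))⁻¹ •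
        crossL (fderiv ℝ g w 1) (fderiv ℝ g w Complex.I)) z :=
      (hlam.differentiableAt.inv (by rwa [real_inner_self_eq_norm_sq])).smul hcr.differentiableAt
    refine h1.congr_of_eventuallyEq ?_
    filter_upwards [hg.isOpen.mem_nhds hz] with w hw
    have : ‖fderiv ℝ g w 1‖ ^ 2 ≠ 0 := (pow_pos (norm_pos_iff.2 (hg.ne_zero w hw)) 2).ne'
    rw [hN w hw, real_inner_self_eq_norm_sq, inv_smul_smul₀ this]
  have hsm := hlam.smul hdiff.hasFDerivAt
  have heq := hcr.unique (hsm.congr_of_eventuallyEq (by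
    filter_upwards [hg.isOpen.mem_nhds hz] with w hw
    simp only [real_inner_self_eq_norm_sq]
    exact hN w hw))
  have hexp : ∀ v : ℂ, crossL (fderiv ℝ g z 1) (secondDeriv g z v Complex.I)
      + crossL (secondDeriv g z v 1) (fderiv ℝ g z Complex.I)
      = ‖fderiv ℝ g z 1‖ ^ 2 • fderiv ℝ N z v
        + (2 * inner ℝ (fderiv ℝ g z 1) (secondDeriv g z v 1)) • N z := by
    intro v
    have := DFunLike.congr_fun heq v
    simp only [ContinuousLinearMap.precompR_apply, ContinuousLinearMap.precompL_apply, add_apply,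
      smul_apply, ContinuousLinearMap.smulRight_apply, real_inner_self_eq_norm_sq,
      ContinuousLinearMap.comp_apply, fderivInnerCLM_apply, ContinuousLinearMap.prod_apply] at this
    rw [real_inner_comm (fderiv ℝ g z 1)] at this
    rw [two_mul]
    exact this
  -- This is the derivative of |g_x|² = |g_y|².
  have hlamv : ∀ v : ℂ, inner ℝ (fderiv ℝ g z 1) (secondDeriv g z v 1)
      = inner ℝ (fderiv ℝ g z Complex.I) (secondDeriv g z v Complex.I) := by
    intro v
    have h2 := hlam.unique ((hdy.inner ℝ hdy).congr_of_eventuallyEq (by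
      filter_upwards [hg.isOpen.mem_nhds hz] with w hw
      simp only [real_inner_self_eq_norm_sq, hg.norm_eq w hw]))
    have := DFunLike.congr_fun h2 v
    simp only [ContinuousLinearMap.comp_apply, fderivInnerCLM_apply,
      ContinuousLinearMap.prod_apply] at this
    rw [real_inner_comm (fderiv ℝ g z 1), real_inner_comm (fderiv ℝ g z Complex.I)] at this
    unfold secondDeriv
    linarith
  have hspan : ∀ a b, ∃ p q r : ℝ, p • g z + q • fderiv ℝ g z 1 + r • fderiv ℝ g z Complex.I
      = secondDeriv g z a b := by
    intro a b
    have := hII a b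
    rwa [sphereSecondFF, starProjection_orthogonal_eq_zero_iff, sub_zero,
      Submodule.mem_span_triple] at this
  have hgx := hg.inner_fderiv hz
  have hxg : ∀ v, inner ℝ (fderiv ℝ g z v) (g z) = 0 := fun v => by rw [real_inner_comm, hgx]
  have hxy := hg.inner_eq_zero z hz
  have hyx : inner ℝ (fderiv ℝ g z Complex.I) (fderiv ℝ g z 1) = 0 := by rwa [real_inner_comm]
  have hmain : ∀ v : ℂ, ‖fderiv ℝ g z 1‖ ^ 2 • fderiv ℝ N z v =
      -(inner ℝ (fderiv ℝ g z 1) (fderiv ℝ g z v)) • crossL (g z) (fderiv ℝ g z Complex.I)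
      + inner ℝ (fderiv ℝ g z Complex.I) (fderiv ℝ g z v) • crossL (g z) (fderiv ℝ g z 1) := by
    intro v
    obtain ⟨p, q, r, h1⟩ := hspan v 1
    obtain ⟨p', q', r', h2⟩ := hspan v Complex.I
    have e1 := hg.inner_secondDeriv hz v 1
    have e2 := hg.inner_secondDeriv hz v Complex.I
    have e3 := hlamv v
    have e4 := hexp v
    rw [← h1, ← h2] at e4 e3
    rw [← h1] at e1
    rw [← h2] at e2
    simp only [inner_add_right, inner_smul_right, hgx, hxg, hxy, hyx, real_inner_self_eq_norm_sq,
      hg.norm_eq_one z hz, ← hg.norm_eq z hz, mul_zero, add_zero, zero_add, one_pow, mul_one]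
      at e1 e2 e3 e4
    -- The tangential coefficients contribute (q + r')|g_x|² N. With q = r' this cancels the term
    -- coming from the derivative of |g_x|², leaving only the components p, p' along g.
    have e5 : q = r' := mul_right_cancel₀ hl0 e3
    simp only [map_add, map_smul, add_apply, smul_apply, crossL_self, hN z hz] at e4
    rw [crossL_swap (fderiv ℝ g z 1) (g z)] at e4
    subst e5
    have e6 : inner ℝ (fderiv ℝ g z 1) (fderiv ℝ g z v) = -p := by
      rw [real_inner_comm, e1, neg_neg]
    have e7 : inner ℝ (fderiv ℝ g z Complex.I) (fderiv ℝ g z v) = -p' := by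
      rw [real_inner_comm, e2, neg_neg]
    rw [e6, e7]
    linear_combination (norm := module) -e4
  have hfd : fderiv ℝ N z = -fderiv ℝ F z := by
    ext1 v
    apply smul_right_injective E7 hl0
    simp only
    rw [hmain v, neg_apply, hF z hz, clm_complex_apply (fderiv ℝ g z) (Complex.I * v),
      clm_complex_apply (fderiv ℝ g z) v]
    simp only [map_add, map_smul, inner_add_right, inner_smul_right, hxy, hyx,
      real_inner_self_eq_norm_sq, ← hg.norm_eq z hz, Complex.mul_re, Complex.mul_im, Complex.I_re,
      Complex.I_im]
    module
  rw [← hfd]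
  exact hdiff.hasFDerivAt

end IsConformalHarmonicOn

/-! ### Rigidity: a constant vector in the span of g, g_x, g_y. -/

/-- The component of `s` orthogonal to `g`, `g_x`, `g_y` (in a conformal coordinate). -/
noncomputable def normalPart (g : ℂ → E7) (w : ℂ) (s : E7) : E7 :=
  s - inner ℝ (g w) s • g w - (inner ℝ (fderiv ℝ g w 1) (fderiv ℝ g w 1))⁻¹ •
    (inner ℝ (fderiv ℝ g w 1) s • fderiv ℝ g w 1
      + inner ℝ (fderiv ℝ g w Complex.I) s • fderiv ℝ g w Complex.I)

namespace IsConformalHarmonicOn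

variable {g : ℂ → E7} {U : Set ℂ} {z : ℂ} {t : E7}

theorem eq_sum_of_mem_span (hg : IsConformalHarmonicOn g U) (hz : z ∈ U)
    (ht : t ∈ Submodule.span ℝ {g z, fderiv ℝ g z 1, fderiv ℝ g z Complex.I}) :
    inner ℝ (fderiv ℝ g z 1) (fderiv ℝ g z 1) • t =
      (inner ℝ (fderiv ℝ g z 1) (fderiv ℝ g z 1) * inner ℝ t (g z)) • g z
      + inner ℝ t (fderiv ℝ g z 1) • fderiv ℝ g z 1
      + inner ℝ t (fderiv ℝ g z Complex.I) • fderiv ℝ g z Complex.I := by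
  obtain ⟨p, q, r, rfl⟩ := Submodule.mem_span_triple.1 ht
  have hxg : ∀ v, inner ℝ (fderiv ℝ g z v) (g z) = 0 := fun v => by
    rw [real_inner_comm, hg.inner_fderiv hz]
  have hyx : inner ℝ (fderiv ℝ g z Complex.I) (fderiv ℝ g z 1) = 0 := by
    rw [real_inner_comm, hg.inner_eq_zero z hz]
  simp only [inner_add_left, real_inner_smul_left, hxg, hyx, hg.inner_fderiv hz,
    hg.inner_eq_zero z hz, real_inner_self_eq_norm_sq, ← hg.norm_eq z hz, hg.norm_eq_one z hz]
  module

/-- Pair the expansion of `eq_sum_of_mem_span` with the fixed vector n and differentiate at z. As n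
is orthogonal to g, g_x, g_y and t at z, only the terms in which the derivative falls on g_x or g_y
inside a pairing with n survive. -/
theorem inner_secondDeriv_of_mem_span (hg : IsConformalHarmonicOn g U) (hz : z ∈ U)
    (ht : ∀ w ∈ U, t ∈ Submodule.span ℝ {g w, fderiv ℝ g w 1, fderiv ℝ g w Complex.I})
    {n : E7} (hn : inner ℝ n (g z) = 0) (hnd : ∀ v, inner ℝ n (fderiv ℝ g z v) = 0) (v : ℂ) :
    inner ℝ t (fderiv ℝ g z 1) * inner ℝ n (secondDeriv g z v 1)
      + inner ℝ t (fderiv ℝ g z Complex.I) * inner ℝ n (secondDeriv g z v Complex.I) = 0 := by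
  have hx := hg.contDiffOn.hasFDerivAt_fderiv_apply hg.isOpen hz 1
  have hy := hg.contDiffOn.hasFDerivAt_fderiv_apply hg.isOpen hz Complex.I
  have h0 := hg.contDiffOn.hasFDerivAt_of_isOpen hg.isOpen hz
  have hc : ∀ s : E7, HasFDerivAt (fun _ : ℂ => s) (0 : ℂ →L[ℝ] E7) z := fun s =>
    hasFDerivAt_const s z
  have hnt : inner ℝ n t = 0 := by
    have h1 := congrArg (inner ℝ n) (hg.eq_sum_of_mem_span hz (ht z hz))
    simp only [inner_add_right, inner_smul_right, hn, hnd, mul_zero, add_zero] at h1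
    refine (mul_eq_zero.1 h1).resolve_left ?_
    rw [real_inner_self_eq_norm_sq]
    exact (pow_pos (norm_pos_iff.2 (hg.ne_zero z hz)) 2).ne'
  have hl := hx.inner ℝ hx
  have hL := hl.mul (hasFDerivAt_const (inner ℝ n t) z)
  have hR := (((hl.mul ((hc t).inner ℝ h0)).mul ((hc n).inner ℝ h0)).add
    (((hc t).inner ℝ hx).mul ((hc n).inner ℝ hx))).add
    (((hc t).inner ℝ hy).mul ((hc n).inner ℝ hy))
  have heq := hL.unique (hR.congr_of_eventuallyEq (by
    filter_upwards [hg.isOpen.mem_nhds hz] with w hw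
    have h1 := congrArg (inner ℝ n) (hg.eq_sum_of_mem_span hw (ht w hw))
    simpa only [inner_add_right, inner_smul_right, Pi.add_apply, Pi.mul_apply] using h1))
  have := DFunLike.congr_fun heq v
  simp [hnt, hn, hnd, fderivInnerCLM_apply] at this
  unfold secondDeriv
  linarith

theorem inner_normalPart (hg : IsConformalHarmonicOn g U) (hz : z ∈ U) (s : E7) :
    inner ℝ (normalPart g z s) (g z) = 0 := by
  have hxg : ∀ v, inner ℝ (fderiv ℝ g z v) (g z) = 0 := fun v => by
    rw [real_inner_comm, hg.inner_fderiv hz]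
  simp only [normalPart, inner_sub_left, inner_add_left, real_inner_smul_left, hxg]
  rw [real_inner_self_eq_norm_sq, hg.norm_eq_one z hz, real_inner_comm]
  ring

theorem inner_fderiv_ne_zero (hg : IsConformalHarmonicOn g U) (hz : z ∈ U) :
    inner ℝ (fderiv ℝ g z 1) (fderiv ℝ g z 1) ≠ 0 :=
  inner_self_ne_zero.2 (hg.ne_zero z hz)

theorem inner_normalPart_fderiv (hg : IsConformalHarmonicOn g U) (hz : z ∈ U) (s : E7) (v : ℂ) :
    inner ℝ (normalPart g z s) (fderiv ℝ g z v) = 0 := by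
  have hyx : inner ℝ (fderiv ℝ g z Complex.I) (fderiv ℝ g z 1) = 0 := by
    rw [real_inner_comm, hg.inner_eq_zero z hz]
  have hl := hg.inner_fderiv_ne_zero hz
  have hII : inner ℝ (fderiv ℝ g z Complex.I) (fderiv ℝ g z Complex.I)
      = inner ℝ (fderiv ℝ g z 1) (fderiv ℝ g z 1) := by
    rw [real_inner_self_eq_norm_sq, real_inner_self_eq_norm_sq, hg.norm_eq z hz]
  rw [clm_complex_apply (fderiv ℝ g z) v]
  simp only [normalPart, inner_sub_left, inner_add_left, real_inner_smul_left, inner_add_right,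
    inner_smul_right, hg.inner_fderiv hz, hg.inner_eq_zero z hz, hyx, hII]
  rw [real_inner_comm s (fderiv ℝ g z 1), real_inner_comm s (fderiv ℝ g z Complex.I)]
  field_simp
  ring

theorem inner_normalPart_self (hg : IsConformalHarmonicOn g U) (hz : z ∈ U) (s : E7) :
    inner ℝ (normalPart g z s) s = inner ℝ (normalPart g z s) (normalPart g z s) := by
  have h : s = normalPart g z s + (inner ℝ (g z) s • g z
      + (inner ℝ (fderiv ℝ g z 1) (fderiv ℝ g z 1))⁻¹ • (inner ℝ (fderiv ℝ g z 1) s • fderiv ℝ g z 1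
        + inner ℝ (fderiv ℝ g z Complex.I) s • fderiv ℝ g z Complex.I)) := by
    unfold normalPart; module
  nth_rw 2 [h]
  simp only [inner_add_right, inner_smul_right, hg.inner_normalPart hz,
    hg.inner_normalPart_fderiv hz]
  ring

theorem continuousAt_normalPart (hg : IsConformalHarmonicOn g U) (hz : z ∈ U) {s : ℂ → E7}
    (hs : ContinuousAt s z) : ContinuousAt (fun w => normalPart g w (s w)) z := by
  have c0 := hg.contDiffOn.continuousOn.continuousAt (hg.isOpen.mem_nhds hz)
  have cd : ∀ v, ContinuousAt (fun w => fderiv ℝ g w v) z := fun v =>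
    (hg.contDiffOn.hasFDerivAt_fderiv_apply hg.isOpen hz v).continuousAt
  have c1 : ContinuousAt (fun w => inner ℝ (g w) (s w) • g w) z := (c0.inner (𝕜 := ℝ) hs).smul c0
  have c2 : ∀ v, ContinuousAt (fun w => inner ℝ (fderiv ℝ g w v) (s w) • fderiv ℝ g w v) z :=
    fun v => ((cd v).inner (𝕜 := ℝ) hs).smul (cd v)
  have c3 : ContinuousAt (fun w => (inner ℝ (fderiv ℝ g w 1) (fderiv ℝ g w 1))⁻¹) z :=
    ((cd 1).inner (𝕜 := ℝ) (cd 1)).inv₀ (hg.inner_fderiv_ne_zero hz)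
  exact (hs.sub c1).sub (c3.smul ((c2 1).add (c2 Complex.I)))

theorem mem_span_of_normalPart_eq_zero {s : E7} (h : normalPart g z s = 0) :
    s ∈ Submodule.span ℝ {g z, fderiv ℝ g z 1, fderiv ℝ g z Complex.I} := by
  rw [Submodule.mem_span_triple]
  refine ⟨inner ℝ (g z) s,
    (inner ℝ (fderiv ℝ g z 1) (fderiv ℝ g z 1))⁻¹ * inner ℝ (fderiv ℝ g z 1) s,
    (inner ℝ (fderiv ℝ g z 1) (fderiv ℝ g z 1))⁻¹ * inner ℝ (fderiv ℝ g z Complex.I) s, ?_⟩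
  rw [normalPart] at h
  linear_combination (norm := module) -h

theorem inner_secondDeriv_expand (hg : IsConformalHarmonicOn g U) (hz : z ∈ U) (n : E7)
    (a b : ℂ) : inner ℝ n (secondDeriv g z a b) = a.re * b.re * inner ℝ n (secondDeriv g z 1 1)
      + (a.re * b.im + a.im * b.re) * inner ℝ n (secondDeriv g z 1 Complex.I)
      + a.im * b.im * inner ℝ n (secondDeriv g z Complex.I Complex.I) := by
  rw [hg.contDiffOn.secondDeriv_eq hg.isOpen hz, clm_complex_apply _ b, clm_complex_apply _ a]
  simp only [add_apply, smul_apply, ← hg.contDiffOn.secondDeriv_eq hg.isOpen hz,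
    inner_add_right, inner_smul_right]
  rw [hg.contDiffOn.secondDeriv_symm hg.isOpen hz Complex.I 1]
  ring

/-- If the spaces spanned by `g`, `g_x`, `g_y` contain a common nonzero vector, then `g` is
totally geodesic. -/
theorem sphereSecondFF_eq_zero_of_mem_span (hg : IsConformalHarmonicOn g U) (ht0 : t ≠ 0)
    (ht : ∀ w ∈ U, t ∈ Submodule.span ℝ {g w, fderiv ℝ g w 1, fderiv ℝ g w Complex.I})
    (hz : z ∈ U) (a b : ℂ) : sphereSecondFF 0 g z a b = 0 := by
  have hPc := hg.continuousAt_normalPart hz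
    (hg.contDiffOn.continuousAt_secondDeriv hg.isOpen hz a b)
  rw [sphereSecondFF, starProjection_orthogonal_eq_zero_iff, sub_zero]
  refine mem_span_of_normalPart_eq_zero ?_
  by_contra hne
  -- A nonzero normal part persists near z; it is shown that t then has no tangential component on a
  -- whole neighbourhood.
  have hev : ∀ᶠ w in 𝓝 z, inner ℝ t (fderiv ℝ g w 1) = 0 ∧
      inner ℝ t (fderiv ℝ g w Complex.I) = 0 := by
    filter_upwards [hg.isOpen.mem_nhds hz, hPc.eventually_ne hne] with w hw hPw
    have hB := hg.inner_secondDeriv_of_mem_span hw ht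
        (hg.inner_normalPart hw (secondDeriv g w a b))
        (hg.inner_normalPart_fderiv hw (secondDeriv g w a b))
    have hH := hg.harmonic w hw (normalPart g w (secondDeriv g w a b))
      (by rw [real_inner_comm, hg.inner_normalPart hw _])
    have h1 := hB 1
    have h2 := hB Complex.I
    rw [real_inner_comm, inner_add_right] at hH
    rw [hg.contDiffOn.secondDeriv_symm hg.isOpen hw Complex.I 1] at h2
    set p := inner ℝ (normalPart g w (secondDeriv g w a b)) (secondDeriv g w 1 1) with hp
    set q := inner ℝ (normalPart g w (secondDeriv g w a b)) (secondDeriv g w 1 Complex.I) with hq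
    set β := inner ℝ t (fderiv ℝ g w 1)
    set γ := inner ℝ t (fderiv ℝ g w Complex.I)
    have hr : inner ℝ (normalPart g w (secondDeriv g w a b))
        (secondDeriv g w Complex.I Complex.I) = -p := by linarith
    rw [hr] at h2
    by_contra hβγ
    have hpos : β ^ 2 + γ ^ 2 ≠ 0 := by
      intro h
      exact hβγ ⟨by nlinarith [sq_nonneg β, sq_nonneg γ], by nlinarith [sq_nonneg β, sq_nonneg γ]⟩
    -- By harmonicity the form paired with n is trace-free, so the relations read βp + γq = 0 and βq
    -- - γp = 0, a system with determinant β² + γ² up to sign.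
    have hp0 : p = 0 := mul_left_cancel₀ hpos (by linear_combination β * h1 - γ * h2)
    have hq0 : q = 0 := mul_left_cancel₀ hpos (by linear_combination γ * h1 + β * h2)
    have hs : inner ℝ (normalPart g w (secondDeriv g w a b)) (secondDeriv g w a b) = 0 := by
      rw [hg.inner_secondDeriv_expand hw, hr, ← hp, ← hq, hp0, hq0]
      ring
    rw [hg.inner_normalPart_self hw, inner_self_eq_zero] at hs
    exact hPw hs
  -- Now t is a multiple of g at z. Differentiating ⟨t, g_x⟩ = 0 and using ⟨g, g_xx⟩ = -|g_x|² shows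
  -- that the multiple is zero.
  have h1 := inner_hasFDerivAt_eq_zero (hasFDerivAt_const t z)
    (hg.contDiffOn.hasFDerivAt_fderiv_apply hg.isOpen hz 1) (hev.mono fun w hw => hw.1) 1
  have h2 := hg.eq_sum_of_mem_span hz (ht z hz)
  rw [hev.self_of_nhds.1, hev.self_of_nhds.2, zero_smul, zero_smul, add_zero, add_zero,
    mul_smul] at h2
  have h3 := smul_right_injective E7 (hg.inner_fderiv_ne_zero hz) h2
  have h4 := hg.inner_secondDeriv hz 1 1
  simp only [zero_apply, inner_zero_left, add_zero] at h1
  change inner ℝ t (secondDeriv g z 1 1) = 0 at h1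
  rw [h3, real_inner_smul_left, h4, mul_eq_zero, neg_eq_zero,
    or_iff_left (hg.inner_fderiv_ne_zero hz)] at h1
  rw [h1, zero_smul] at h3
  exact ht0 h3

end IsConformalHarmonicOn

/-! ### Passage between charts and the surface. -/

section Charts

variable {S : Type*} [TopologicalSpace S] [ChartedSpace ℂ S]

theorem isManifold_real_of_complex [IsManifold 𝓘(ℂ, ℂ) ω S] : IsManifold 𝓘(ℝ, ℂ) ∞ S := by
  refine isManifold_of_contDiffOn _ _ _ fun e e' he he' => ?_
  have h := (contDiffGroupoid ω 𝓘(ℂ, ℂ)).compatible he he'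
  rw [contDiffGroupoid, mem_groupoid_of_pregroupoid, contDiffPregroupoid] at h
  have h1 : ContDiffOn ℂ ω (e.symm.trans e') (e.symm.trans e').source := by
    simpa [contDiffPregroupoid] using h.1
  simpa using (h1.restrict_scalars ℝ).of_le le_top

/-- A function on a connected surface whose differential vanishes is constant. -/
theorem eq_of_hasFDerivAt_zero [ConnectedSpace S] {E : Type*} [NormedAddCommGroup E]
    [NormedSpace ℝ E] {f : S → E}
    (hf : ∀ e ∈ atlas ℂ S, ∀ z ∈ e.target, HasFDerivAt (f ∘ e.symm) (0 : ℂ →L[ℝ] E) z) (p q : S) :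
    f p = f q := by
  have hloc : IsLocallyConstant f := by
    rw [IsLocallyConstant.iff_eventually_eq]
    intro p
    set e := chartAt ℂ p
    have hp : p ∈ e.source := mem_chart_source ℂ p
    obtain ⟨r, hr, hball⟩ := Metric.isOpen_iff.1 e.open_target (e p) (e.map_source hp)
    have hev : ∀ᶠ q in 𝓝 p, q ∈ e.source ∧ e q ∈ Metric.ball (e p) r :=
      (e.open_source.eventually_mem hp).and
        ((e.continuousAt hp).eventually_mem (Metric.ball_mem_nhds _ hr))
    filter_upwards [hev] with q hq
    have hh := fun z hz => hf e (chart_mem_atlas ℂ p) z (hball hz)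
    have := (convex_ball (e p) r).is_const_of_fderivWithin_eq_zero (𝕜 := ℝ) (f := f ∘ e.symm)
      (fun z hz => (hh z hz).differentiableAt.differentiableWithinAt)
      (fun z hz => by
        rw [fderivWithin_of_isOpen Metric.isOpen_ball hz, (hh z hz).fderiv])
      hq.2 (Metric.mem_ball_self hr)
    simpa [hp, hq.1] using this
  exact hloc.apply_eq_of_preconnectedSpace p q

/-- Conjugating the coordinate replaces the direction I * v by -I times the conjugate of v, which
changes the sign of the equation. -/
theorem complexLinear_conjAtlas_iff (φ : S → E7) :
    (∀ e ∈ conjAtlas S, ∀ z ∈ e.target, ∀ v : ℂ, fderiv ℝ (φ ∘ e.symm) z (Complex.I * v) =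
      cross7 (φ (e.symm z)) (fderiv ℝ (φ ∘ e.symm) z v)) ↔
    ∀ e ∈ atlas ℂ S, ∀ z ∈ e.target, ∀ v : ℂ, fderiv ℝ (φ ∘ e.symm) z (Complex.I * v) =
      -crossL (φ (e.symm z)) (fderiv ℝ (φ ∘ e.symm) z v) := by
  have key : ∀ (e : OpenPartialHomeomorph S ℂ) (z v : ℂ),
      fderiv ℝ (φ ∘ (e.trans Complex.conjCLE.toHomeomorph.toOpenPartialHomeomorph).symm) z v
        = fderiv ℝ (φ ∘ e.symm) (starRingEnd ℂ z) (starRingEnd ℂ v) := by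
    intro e z v
    have h : φ ∘ (e.trans Complex.conjCLE.toHomeomorph.toOpenPartialHomeomorph).symm
        = (φ ∘ e.symm) ∘ Complex.conjCLE := by
      ext1 w; rfl
    rw [h, Complex.conjCLE.comp_right_fderiv]
    rfl
  have hsymm : ∀ (e : OpenPartialHomeomorph S ℂ) (z : ℂ),
      (e.trans Complex.conjCLE.toHomeomorph.toOpenPartialHomeomorph).symm z
        = e.symm (starRingEnd ℂ z) := fun e z => rfl
  have htar : ∀ (e : OpenPartialHomeomorph S ℂ) (z : ℂ),
      z ∈ (e.trans Complex.conjCLE.toHomeomorph.toOpenPartialHomeomorph).target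
        ↔ starRingEnd ℂ z ∈ e.target := by
    intro e z
    rw [OpenPartialHomeomorph.trans_target]
    simp only [Homeomorph.toOpenPartialHomeomorph_target, Set.univ_inter]
    rfl
  constructor
  · intro h e he z hz v
    have h1 := h _ ⟨e, he, rfl⟩ (starRingEnd ℂ z) ((htar _ _).2 (by simpa using hz))
      (starRingEnd ℂ v)
    rw [key, key, hsymm] at h1
    simp only [map_mul, Complex.conj_I, Complex.conj_conj, neg_mul, map_neg] at h1
    rw [crossL_apply, ← h1, neg_neg]
  · rintro h _ ⟨e, he, rfl⟩ z hz v
    have h1 := h e he (starRingEnd ℂ z) ((htar _ _).1 hz) (starRingEnd ℂ v)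
    simp only [key, hsymm]
    rw [map_mul, Complex.conj_I, neg_mul, map_neg, h1, neg_neg, crossL_apply]

theorem IsAlmostComplexCurve.exists_sign {A : Set (OpenPartialHomeomorph S ℂ)}
    (hA : A = atlas ℂ S ∨ A = conjAtlas S) {φ : S → E7} (hφ : IsAlmostComplexCurve A φ) :
    ∃ ε : ℝ, ε * ε = 1 ∧ ∀ e ∈ atlas ℂ S, ∀ z ∈ e.target, ∀ v : ℂ,
      fderiv ℝ (φ ∘ e.symm) z (Complex.I * v) =
        ε • crossL (φ (e.symm z)) (fderiv ℝ (φ ∘ e.symm) z v) := by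
  rcases hA with rfl | rfl
  · exact ⟨1, by norm_num, by simpa [crossL_apply] using hφ.complex_linear⟩
  · exact ⟨-1, by norm_num, by simpa using (complexLinear_conjAtlas_iff φ).1 hφ.complex_linear⟩

variable [IsManifold 𝓘(ℂ, ℂ) ω S]

theorem IsSmoothMap.contDiffOn_comp_symm {f : S → E7} (hf : IsSmoothMap f)
    {e : OpenPartialHomeomorph S ℂ} (he : e ∈ atlas ℂ S) :
    ContDiffOn ℝ ∞ (f ∘ e.symm) e.target := by
  have := isManifold_real_of_complex (S := S)
  have h := hf.comp_contMDiffOn (contMDiffOn_symm_of_mem_maximalAtlas (I := 𝓘(ℝ, ℂ)) (n := ∞)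
    (IsManifold.subset_maximalAtlas he))
  exact contMDiffOn_iff_contDiffOn.1 h

theorem IsSmoothMap.hasFDerivAt_comp_symm {f : S → E7} (hf : IsSmoothMap f)
    {e : OpenPartialHomeomorph S ℂ} (he : e ∈ atlas ℂ S) {z : ℂ} (hz : z ∈ e.target) :
    HasFDerivAt (f ∘ e.symm) (fderiv ℝ (f ∘ e.symm) z) z :=
  (hf.contDiffOn_comp_symm he).hasFDerivAt_of_isOpen e.open_target hz

theorem IsConformalHarmonicImmersion.isConformalHarmonicOn {φ : S → E7}
    (hφ : IsConformalHarmonicImmersion φ) {e : OpenPartialHomeomorph S ℂ} (he : e ∈ atlas ℂ S) :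
    IsConformalHarmonicOn (φ ∘ e.symm) e.target where
  isOpen := e.open_target
  contDiffOn := hφ.immersion.1.contDiffOn_comp_symm he
  norm_eq_one z _ := by simpa using hφ.mem_sphere (e.symm z)
  ne_zero z hz h := one_ne_zero (hφ.immersion.2 e he z hz (h.trans (map_zero _).symm))
  norm_eq := hφ.norm_eq e he
  inner_eq_zero := hφ.inner_eq_zero e he
  harmonic := hφ.harmonic e he

/-- The differentials of `f` in two charts differ by a complex factor. -/
theorem IsSmoothMap.exists_fderiv_comp_symm {f : S → E7} (hf : IsSmoothMap f)
    {e e' : OpenPartialHomeomorph S ℂ} (he : e ∈ atlas ℂ S) (he' : e' ∈ atlas ℂ S) {p : S}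
    (hp : p ∈ e.source) (hp' : p ∈ e'.source) :
    ∃ a : ℂ, ∀ v, fderiv ℝ (f ∘ e'.symm) (e' p) v = fderiv ℝ (f ∘ e.symm) (e p) (a * v) := by
  have h := (contDiffGroupoid ω 𝓘(ℂ, ℂ)).compatible he' he
  have h1 : ContDiffOn ℂ ω (e'.symm.trans e) (e'.symm.trans e).source := by
    rw [contDiffGroupoid, mem_groupoid_of_pregroupoid] at h
    simpa [contDiffPregroupoid] using h.1
  have hmem : e' p ∈ (e'.symm.trans e).source := by simp [hp, hp']
  have hd : DifferentiableAt ℂ (e'.symm.trans e) (e' p) :=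
    (h1.contDiffAt ((e'.symm.trans e).open_source.mem_nhds hmem)).differentiableAt (by simp)
  have hd' := hd.hasFDerivAt.restrictScalars ℝ
  have hval : (e'.symm.trans e) (e' p) = e p := by simp [hp']
  have hfe := hf.hasFDerivAt_comp_symm he (e.map_source hp)
  rw [← hval] at hfe
  have hc := hfe.comp (e' p) hd'
  have heq : f ∘ e'.symm =ᶠ[𝓝 (e' p)] (f ∘ e.symm) ∘ (e'.symm.trans e) := by
    filter_upwards [(e'.symm.trans e).open_source.mem_nhds hmem] with w hw
    have hw' : e'.symm w ∈ e.source := by simpa using hw.2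
    simp [hw']
  refine ⟨fderiv ℂ (e'.symm.trans e) (e' p) 1, fun v => ?_⟩
  rw [heq.fderiv_eq, hc.fderiv, hval, ContinuousLinearMap.comp_apply]
  congr 1
  rw [ContinuousLinearMap.coe_restrictScalars', mul_comm, ← smul_eq_mul, ← map_smul]
  simp

end Charts

/-! ### The equation dN = -dF and sufficiency of the three conditions. -/

section Surfaces

variable {S : Type*} [TopologicalSpace S] [ChartedSpace ℂ S]

/-- `N` is the cross product of an oriented orthonormal frame of the tangent planes of `φ`. -/
def IsNormalField (φ N : S → E7) : Prop :=
  ∀ e ∈ atlas ℂ S, ∀ z ∈ e.target,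
    crossL (fderiv ℝ (φ ∘ e.symm) z 1) (fderiv ℝ (φ ∘ e.symm) z Complex.I)
      = ‖fderiv ℝ (φ ∘ e.symm) z 1‖ ^ 2 • N (e.symm z)

variable [IsManifold 𝓘(ℂ, ℂ) ω S] {φ F N : S → E7}

theorem IsNormalField.norm_eq_one (hφ : IsConformalHarmonicImmersion φ) (hN : IsNormalField φ N)
    (p : S) : ‖N p‖ = 1 := by
  have he := chart_mem_atlas ℂ p
  have hz := mem_chart_target ℂ p
  have hg := hφ.isConformalHarmonicOn he
  have := norm_normal_eq_one (hg.ne_zero _ hz) (hg.norm_eq _ hz) (hg.inner_eq_zero _ hz)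
    (hN _ he _ hz)
  rwa [(chartAt ℂ p).left_inv (mem_chart_source ℂ p)] at this

/-- F + N is constant; its value is the centre, the radius is |N| = 1, and ΔF, a multiple of N, is
radial. -/
theorem IsNormalField.isMinimalInSomeHypersphere [ConnectedSpace S]
    (hφ : IsConformalHarmonicImmersion φ) (hF : IsAssociatedSurface φ F) (hN : IsNormalField φ N)
    (hd : ∀ e ∈ atlas ℂ S, ∀ z ∈ e.target,
      HasFDerivAt (N ∘ e.symm) (-fderiv ℝ (F ∘ e.symm) z) z) :
    IsMinimalInSomeHypersphere F := by
  obtain ⟨p₀⟩ : Nonempty S := inferInstance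
  have hc : ∀ p, F p - (F p₀ + N p₀) = -N p := by
    intro p
    have := eq_of_hasFDerivAt_zero (f := fun p => F p + N p) (fun e he z hz => by
      have h1 := (hF.1.hasFDerivAt_comp_symm he hz).add (hd e he z hz)
      rw [add_neg_cancel] at h1
      exact h1) p p₀
    rw [← this]
    abel
  refine ⟨⟨hF.1, fun e he z hz => ?_⟩, F p₀ + N p₀, 1, one_pos, fun p => ?_, fun e he z hz => ?_⟩
  · have hg := hφ.isConformalHarmonicOn he
    rw [injective_iff_map_eq_zero]
    intro v hv
    have h1 := norm_crossL_of_inner_eq_zero (hg.inner_fderiv hz (Complex.I * v))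
    have h2 : crossL ((φ ∘ e.symm) z) (fderiv ℝ (φ ∘ e.symm) z (Complex.I * v)) = 0 :=
      (hF.2 e he z hz v).symm.trans hv
    rw [h2, hg.norm_eq_one z hz, norm_zero, one_mul] at h1
    have h3 := hφ.immersion.2 e he z hz ((norm_eq_zero.1 h1.symm).trans (map_zero _).symm)
    simpa using h3
  · rw [mem_sphere_iff_norm, hc, norm_neg, hN.norm_eq_one hφ]
  · have hg := hφ.isConformalHarmonicOn he
    rw [hg.sphereMeanCurvature_associated_eq_zero_iff (hF.2 e he) hz, hN e he z hz]
    have h1 : N (e.symm z) = -((F ∘ e.symm) z - (F p₀ + N p₀)) := by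
      rw [Function.comp_apply, hc, neg_neg]
    rw [h1]
    exact Submodule.smul_mem _ _ (Submodule.neg_mem _ (Submodule.subset_span (by simp)))

theorem IsMinimalInSomeHypersphere.exists_isNormalField
    (hφ : IsConformalHarmonicImmersion φ) (hF : IsAssociatedSurface φ F)
    (h : IsMinimalInSomeHypersphere F) :
    ∃ N : S → E7, IsNormalField φ N ∧ ∀ e ∈ atlas ℂ S, ∀ z ∈ e.target,
      HasFDerivAt (N ∘ e.symm) (-fderiv ℝ (F ∘ e.symm) z) z := by
  obtain ⟨-, c, r, hr, hc, hH⟩ := h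
  refine ⟨fun p => c - F p, fun e he z hz => ?_, fun e he z hz => ?_⟩
  · exact (hφ.isConformalHarmonicOn he).crossL_eq_of_minimal (hF.1.contDiffOn_comp_symm he)
      (hF.2 e he) hr (fun w _ => mem_sphere_iff_norm.1 (hc (e.symm w))) hz (hH e he z hz)
  · exact (hF.1.hasFDerivAt_comp_symm he hz).const_sub c

theorem isMinimal_of_isAlmostComplexCurve [ConnectedSpace S]
    (hφ : IsConformalHarmonicImmersion φ) (hF : IsAssociatedSurface φ F)
    {A : Set (OpenPartialHomeomorph S ℂ)} (hA : A = atlas ℂ S ∨ A = conjAtlas S)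
    (h : IsAlmostComplexCurve A φ) : IsMinimalInSomeHypersphere F := by
  obtain ⟨ε, hε, hJ⟩ := h.exists_sign hA
  -- From φ_y = ε φ × φ_x the double cross product gives φ_x × φ_y = ε|φ_x|² φ, hence N = εφ.
  refine IsNormalField.isMinimalInSomeHypersphere (N := fun p => ε • φ p) hφ hF
    (fun e he z hz => ?_) (fun e he z hz => ?_)
  · have hg := hφ.isConformalHarmonicOn he
    have h1 := hJ e he z hz 1
    have h2 : inner ℝ (fderiv ℝ (φ ∘ e.symm) z 1) (φ (e.symm z)) = 0 := by
      rw [real_inner_comm]; exact hg.inner_fderiv hz 1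
    rw [mul_one] at h1
    rw [h1, map_smul, crossL_swap (φ _), map_neg, crossL_crossL_self, h2,
      real_inner_self_eq_norm_sq]
    module
  · have h1 : -fderiv ℝ (F ∘ e.symm) z = ε • fderiv ℝ (φ ∘ e.symm) z := by
      ext1 v
      have h2 := hJ e he z hz (Complex.I * v)
      rw [← mul_assoc, Complex.I_mul_I, neg_one_mul, map_neg] at h2
      have h3 : crossL (φ (e.symm z)) (fderiv ℝ (φ ∘ e.symm) z (Complex.I * v))
          = -ε • fderiv ℝ (φ ∘ e.symm) z v := by
        rw [neg_smul, ← smul_neg, h2, smul_smul, hε, one_smul]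
      rw [neg_apply, smul_apply, hF.2 e he z hz, ← crossL_apply, h3]
      module
    rw [h1]
    exact (hφ.immersion.1.hasFDerivAt_comp_symm he hz).const_smul ε

theorem isMinimal_of_eq_rot7 [ConnectedSpace S]
    (hφ : IsConformalHarmonicImmersion φ) (hF : IsAssociatedSurface φ F)
    {A : Set (OpenPartialHomeomorph S ℂ)} (hA : A = atlas ℂ S ∨ A = conjAtlas S)
    {v : E7} {β : ℝ} {φ' : S → E7} (hv : ‖v‖ = 1) (h : IsAlmostComplexCurve A φ')
    (hvφ : ∀ p, inner ℝ v (φ' p) = 0) (hrot : ∀ p, φ p = rot7 v β (φ' p)) :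
    IsMinimalInSomeHypersphere F := by
  obtain ⟨ε, hε, hJ⟩ := h.exists_sign hA
  have hφ' : ∀ e ∈ atlas ℂ S, φ ∘ e.symm = rotL v β ∘ (φ' ∘ e.symm) := by
    intro e _
    ext1 w
    simp [hrot, rotL_apply]
  have hd' : ∀ e ∈ atlas ℂ S, ∀ z ∈ e.target, ∀ w, fderiv ℝ (φ ∘ e.symm) z w
      = rotL v β (fderiv ℝ (φ' ∘ e.symm) z w) := by
    intro e he z hz w
    have h1 := (rotL v β).hasFDerivAt.comp z (h.smooth.hasFDerivAt_comp_symm he hz)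
    rw [hφ' e he, h1.fderiv]
    rfl
  have hvd : ∀ e ∈ atlas ℂ S, ∀ z ∈ e.target, ∀ w,
      inner ℝ v (fderiv ℝ (φ' ∘ e.symm) z w) = 0 := by
    intro e he z hz w
    have h1 := inner_hasFDerivAt_eq_zero (hasFDerivAt_const v z)
      (h.smooth.hasFDerivAt_comp_symm he hz) (Eventually.of_forall fun w => hvφ (e.symm w)) w
    simpa using h1
  have hortho : ∀ e ∈ atlas ℂ S, ∀ z ∈ e.target, ∀ w,
      inner ℝ (φ' (e.symm z)) (fderiv ℝ (φ' ∘ e.symm) z w) = 0 := by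
    intro e he z hz w
    have := inner_fderiv_eq_zero_of_norm_eq (c := 0) (r := 1) (h.smooth.contDiffOn_comp_symm he)
      e.open_target hz (fun w _ => by simpa using h.mem_sphere (e.symm w)) w
    simpa using this
  have hcr : ∀ e ∈ atlas ℂ S, ∀ z ∈ e.target, ∀ w,
      crossL (φ' (e.symm z)) (fderiv ℝ (φ' ∘ e.symm) z w)
        = ε • fderiv ℝ (φ' ∘ e.symm) z (Complex.I * w) := by
    intro e he z hz w
    rw [hJ e he z hz w, smul_smul, hε, one_smul]
  -- For φ' the normal is εφ'. Rotating both tangent vectors by β rotates their cross product by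
  -- -2β.
  refine IsNormalField.isMinimalInSomeHypersphere
    (N := fun p => ε • rotL v (-(β + β)) (φ' p)) hφ hF
    (fun e he z hz => ?_) (fun e he z hz => ?_)
  · have h0 : inner ℝ (fderiv ℝ (φ' ∘ e.symm) z 1) (φ' (e.symm z)) = 0 := by
      rw [real_inner_comm, hortho e he z hz]
    have h1 : crossL (fderiv ℝ (φ' ∘ e.symm) z 1) (fderiv ℝ (φ' ∘ e.symm) z Complex.I)
        = (ε * ‖fderiv ℝ (φ' ∘ e.symm) z 1‖ ^ 2) • φ' (e.symm z) := by
      have h2 := hJ e he z hz 1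
      rw [mul_one] at h2
      rw [h2, map_smul, crossL_swap (φ' _), map_neg, crossL_crossL_self, h0,
        real_inner_self_eq_norm_sq]
      module
    have h2 : inner ℝ (fderiv ℝ (φ' ∘ e.symm) z 1) (fderiv ℝ (φ' ∘ e.symm) z Complex.I) = 0 := by
      have h2 := hJ e he z hz 1
      rw [mul_one] at h2
      rw [h2, inner_smul_right, inner_crossL_self_right, mul_zero]
    rw [hd' e he z hz, hd' e he z hz, crossL_rotL_rotL hv β β (hvd e he z hz 1)
      (hvd e he z hz Complex.I) h2 (by rw [h1, inner_smul_right, hvφ, mul_zero]),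
      norm_rotL hv β (hvd e he z hz 1), h1, map_smul]
    module
  · have h1 : -fderiv ℝ (F ∘ e.symm) z
        = ε • (rotL v (-(β + β))).comp (fderiv ℝ (φ' ∘ e.symm) z) := by
      ext1 w
      have h3 := hcr e he z hz (Complex.I * w)
      rw [← mul_assoc, Complex.I_mul_I, neg_one_mul, map_neg] at h3
      rw [neg_apply, smul_apply, hF.2 e he z hz, ← crossL_apply, hrot, ← rotL_apply,
        hd' e he z hz, crossL_rotL_rotL hv β β (hvφ _) (hvd e he z hz _) (hortho e he z hz _)
          (by rw [h3, inner_smul_right, inner_neg_right, hvd e he z hz]; simp), h3,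
        ContinuousLinearMap.comp_apply, map_smul, map_neg]
      module
    rw [h1]
    exact ((rotL v (-(β + β))).hasFDerivAt.comp z
      (h.smooth.hasFDerivAt_comp_symm he hz)).const_smul ε

theorem isMinimal_of_isTotallyGeodesicInSphere [ConnectedSpace S]
    (hφ : IsConformalHarmonicImmersion φ) (hF : IsAssociatedSurface φ F)
    (h : IsTotallyGeodesicInSphere φ) : IsMinimalInSomeHypersphere F := by
  -- N is defined through the preferred chart at each point. A chart change multiplies the
  -- differential by a complex number a, which scales both φ_x × φ_y and |φ_x|² by |a|², so the
  -- relation holds in every chart.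
  let D : S → ℂ →L[ℝ] E7 := fun p => fderiv ℝ (φ ∘ (chartAt ℂ p).symm) (chartAt ℂ p p)
  let N : S → E7 := fun p => (‖D p 1‖ ^ 2)⁻¹ • crossL (D p 1) (D p Complex.I)
  have hN : IsNormalField φ N := by
    intro e he z hz
    set p := e.symm z with hp
    have he' := chart_mem_atlas ℂ p
    have hps : p ∈ (chartAt ℂ p).source := mem_chart_source ℂ p
    obtain ⟨a, ha⟩ := hφ.immersion.1.exists_fderiv_comp_symm he' he hps (e.map_target hz)
    have hg := hφ.isConformalHarmonicOn he'
    have hz' := mem_chart_target ℂ p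
    have hne : ‖D p 1‖ ^ 2 ≠ 0 := (pow_pos (norm_pos_iff.2 (hg.ne_zero _ hz')) 2).ne'
    have hD : ∀ w, fderiv ℝ (φ ∘ e.symm) z w = D p (a * w) := by
      intro w
      rw [← ha w, hp, e.right_inv hz]
    have hI : ‖D p Complex.I‖ = ‖D p 1‖ := (hg.norm_eq _ hz').symm
    have h0 : inner ℝ (D p 1) (D p Complex.I) = 0 := hg.inner_eq_zero _ hz'
    have h1 : crossL (D p (a * 1)) (D p (a * Complex.I))
        = (a.re ^ 2 + a.im ^ 2) • crossL (D p 1) (D p Complex.I) := by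
      rw [clm_complex_apply (D p) (a * 1), clm_complex_apply (D p) (a * Complex.I)]
      simp only [map_add, map_smul, add_apply, smul_apply, crossL_self,
        crossL_swap (D p Complex.I) (D p 1), mul_one, Complex.mul_re, Complex.mul_im,
        Complex.I_re, Complex.I_im]
      module
    have h2 : ‖D p (a * 1)‖ ^ 2 = (a.re ^ 2 + a.im ^ 2) * ‖D p 1‖ ^ 2 := by
      rw [clm_complex_apply (D p) (a * 1), mul_one, ← real_inner_self_eq_norm_sq]
      simp only [inner_add_left, inner_add_right, inner_smul_right, real_inner_smul_left, h0,
        real_inner_comm (D p 1) (D p Complex.I), real_inner_self_eq_norm_sq, hI]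
      ring
    rw [hD, hD, h1, h2, mul_smul]
    simp only [N]
    rw [smul_inv_smul₀ hne]
  refine hN.isMinimalInSomeHypersphere hφ hF fun e he z hz => ?_
  exact (hφ.isConformalHarmonicOn he).hasFDerivAt_normal_of_totallyGeodesic (hF.2 e he) hz
    (h e he z hz) (hN e he)

end Surfaces

/-! ### Necessity: constants of dN = -dF and the case distinction. -/

theorem IsConformalHarmonicOn.mem_span_of_orthogonal {g : ℂ → E7} {U : Set ℂ} {z : ℂ}
    (hg : IsConformalHarmonicOn g U) (hz : z ∈ U) {v u : E7} (hv : v ≠ 0)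
    (hvg : inner ℝ v (g z) = 0) (hvd : ∀ w, inner ℝ v (fderiv ℝ g z w) = 0)
    (hvgd : ∀ w, inner ℝ v (crossL (g z) (fderiv ℝ g z w)) = 0)
    (hvn : inner ℝ v (crossL (fderiv ℝ g z 1) (fderiv ℝ g z Complex.I)) = 0)
    (hvu : inner ℝ v u = 0) (hug : inner ℝ u (g z) = 0)
    (hud : ∀ w, inner ℝ u (fderiv ℝ g z w) = 0) :
    crossL v u ∈ Submodule.span ℝ {g z, fderiv ℝ g z 1, fderiv ℝ g z Complex.I} := by
  -- The normal part of v × u is orthogonal to g, g_x, g_y by construction. It is orthogonal to v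
  -- and to the v-products of g, g_x, g_y because these are orthogonal both to v × u and to g, g_x,
  -- g_y. These seven vectors span.
  refine mem_span_of_normalPart_eq_zero ?_
  have hI : fderiv ℝ g z Complex.I ≠ 0 := by
    rw [← norm_ne_zero_iff, ← hg.norm_eq z hz]; exact norm_ne_zero_iff.2 (hg.ne_zero z hz)
  have hg0 : g z ≠ 0 := by
    rw [← norm_ne_zero_iff, hg.norm_eq_one z hz]; exact one_ne_zero
  have key : ∀ y, inner ℝ (g z) y = 0 → inner ℝ (fderiv ℝ g z 1) y = 0 →
      inner ℝ (fderiv ℝ g z Complex.I) y = 0 → inner ℝ (crossL v u) y = 0 →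
      inner ℝ (normalPart g z (crossL v u)) y = 0 := by
    intro y h0 h1 h2 h3
    simp only [normalPart, inner_sub_left, inner_add_left, real_inner_smul_left, h0, h1, h2, h3]
    simp
  have hflip : ∀ {a b : E7}, inner ℝ v (crossL a b) = 0 →
      inner ℝ a (crossL v b) = 0 ∧ inner ℝ b (crossL v a) = 0 := by
    intro a b h
    constructor
    · rw [inner_crossL_swap, h, neg_zero]
    · rw [inner_crossL_swap, crossL_swap, inner_neg_right, h]; simp
  have hvv : ∀ y, inner ℝ u y = 0 → inner ℝ (crossL v u) (crossL v y) = 0 := by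
    intro y h
    rw [inner_crossL_crossL, h, hvu]; simp
  refine eq_zero_of_orthogonal_frame hv hg0 (hg.ne_zero z hz) hI hvg (hvd 1) (hvd _)
    (hg.inner_fderiv hz 1) (hg.inner_fderiv hz _) (hg.inner_eq_zero z hz) (hvgd 1) (hvgd _) hvn
    ?_ (hg.inner_normalPart hz _) (hg.inner_normalPart_fderiv hz _ _)
    (hg.inner_normalPart_fderiv hz _ _) ?_ ?_ ?_
  · apply key
    · rw [real_inner_comm, hvg]
    · rw [real_inner_comm, hvd]
    · rw [real_inner_comm, hvd]
    · rw [real_inner_comm, inner_crossL_self_left]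
  · exact key _ (inner_crossL_self_right _ _) (hflip (hvgd 1)).2 (hflip (hvgd _)).2 (hvv _ hug)
  · exact key _ (hflip (hvgd 1)).1 (inner_crossL_self_right _ _) (hflip hvn).2 (hvv _ (hud 1))
  · exact key _ (hflip (hvgd _)).1 (hflip hvn).1 (inner_crossL_self_right _ _) (hvv _ (hud _))

section Surfaces

variable {S : Type*} [TopologicalSpace S] [ChartedSpace ℂ S] {φ F N : S → E7}

theorem IsConformalHarmonicImmersion.nonconstant [Nonempty S]
    (hφ : IsConformalHarmonicImmersion φ) : ∃ p q, φ p ≠ φ q := by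
  by_contra! h
  obtain ⟨p⟩ := ‹Nonempty S›
  have h1 : φ ∘ (chartAt ℂ p).symm = fun _ => φ p := by
    ext1 w; exact h _ _
  have h2 := hφ.immersion.2 _ (chart_mem_atlas ℂ p) _ (mem_chart_target ℂ p)
  rw [h1] at h2
  exact one_ne_zero (h2 (show _ = fderiv ℝ (fun _ => φ p) _ 0 by simp))

variable [IsManifold 𝓘(ℂ, ℂ) ω S]

theorem IsNormalField.inner_fderiv (hφ : IsConformalHarmonicImmersion φ) (hN : IsNormalField φ N)
    {e : OpenPartialHomeomorph S ℂ} (he : e ∈ atlas ℂ S) {z : ℂ} (hz : z ∈ e.target) (w : ℂ) :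
    inner ℝ (N (e.symm z)) (fderiv ℝ (φ ∘ e.symm) z w) = 0 :=
  inner_normal_apply ((hφ.isConformalHarmonicOn he).ne_zero z hz) (hN e he z hz) w

theorem IsNormalField.crossL_fderiv (hφ : IsConformalHarmonicImmersion φ)
    (hN : IsNormalField φ N) {e : OpenPartialHomeomorph S ℂ} (he : e ∈ atlas ℂ S) {z : ℂ}
    (hz : z ∈ e.target) (w : ℂ) :
    crossL (N (e.symm z)) (fderiv ℝ (φ ∘ e.symm) z w)
      = fderiv ℝ (φ ∘ e.symm) z (Complex.I * w) :=
  have hg := hφ.isConformalHarmonicOn he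
  crossL_normal_apply (hg.ne_zero z hz) (hg.norm_eq z hz) (hg.inner_eq_zero z hz) (hN e he z hz) w

/-- dN = -dF is orthogonal to φ by the form of dF, and N is orthogonal to dφ. -/
theorem IsNormalField.inner_eq [ConnectedSpace S] (hφ : IsConformalHarmonicImmersion φ)
    (hF : IsAssociatedSurface φ F) (hN : IsNormalField φ N)
    (hd : ∀ e ∈ atlas ℂ S, ∀ z ∈ e.target,
      HasFDerivAt (N ∘ e.symm) (-fderiv ℝ (F ∘ e.symm) z) z) (p q : S) :
    inner ℝ (N p) (φ p) = inner ℝ (N q) (φ q) := by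
  refine eq_of_hasFDerivAt_zero (f := fun p => inner ℝ (N p) (φ p)) (fun e he z hz => ?_) p q
  have h := (hd e he z hz).inner ℝ (hφ.immersion.1.hasFDerivAt_comp_symm he hz)
  refine h.congr_fderiv ?_
  ext1 w
  have h1 : inner ℝ (fderiv ℝ (F ∘ e.symm) z w) (φ (e.symm z)) = 0 := by
    rw [hF.2 e he z hz, ← crossL_apply, real_inner_comm, inner_crossL_self_left]
  simp [fderivInnerCLM_apply, hN.inner_fderiv hφ he hz, h1]

/-- φ × dN = -φ × (φ × *dφ) = *dφ, while dφ × N = -N × dφ = -*dφ. -/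
theorem IsNormalField.crossL_eq [ConnectedSpace S] (hφ : IsConformalHarmonicImmersion φ)
    (hF : IsAssociatedSurface φ F) (hN : IsNormalField φ N)
    (hd : ∀ e ∈ atlas ℂ S, ∀ z ∈ e.target,
      HasFDerivAt (N ∘ e.symm) (-fderiv ℝ (F ∘ e.symm) z) z) (p q : S) :
    crossL (φ p) (N p) = crossL (φ q) (N q) := by
  refine eq_of_hasFDerivAt_zero (f := fun p => crossL (φ p) (N p)) (fun e he z hz => ?_) p q
  have h := crossL.hasFDerivAt_of_bilinear (hφ.immersion.1.hasFDerivAt_comp_symm he hz)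
    (hd e he z hz)
  refine h.congr_fderiv ?_
  ext1 w
  have hg := hφ.isConformalHarmonicOn he
  have h0 : inner ℝ (φ (e.symm z)) (fderiv ℝ (φ ∘ e.symm) z (Complex.I * w)) = 0 :=
    hg.inner_fderiv hz _
  have h1 : ‖φ (e.symm z)‖ = 1 := hg.norm_eq_one z hz
  change crossL (φ (e.symm z)) (-fderiv ℝ (F ∘ e.symm) z w)
    + crossL (fderiv ℝ (φ ∘ e.symm) z w) (N (e.symm z)) = 0
  rw [hF.2 e he z hz, ← crossL_apply, map_neg, crossL_crossL_self, h0,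
    crossL_swap _ (N _), hN.crossL_fderiv hφ he hz, real_inner_self_eq_norm_sq, h1]
  module

/-- A family of vectors orthogonal to a unit vector `v` such that every vector orthogonal to `v`
and to the family vanishes spans a six-dimensional space. -/
theorem finrank_span_eq_six {ι : Type*} {f : ι → E7} {v : E7} (hv : ‖v‖ = 1)
    (hvf : ∀ i, inner ℝ v (f i) = 0)
    (h : ∀ u, inner ℝ v u = 0 → (∀ i, inner ℝ u (f i) = 0) → u = 0) :
    Module.finrank ℝ (Submodule.span ℝ (Set.range f)) = 6 := by
  have hmem : ∀ u, u ∈ (Submodule.span ℝ (Set.range f))ᗮ ↔ ∀ i, inner ℝ u (f i) = 0 := by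
    intro u
    rw [Submodule.mem_orthogonal']
    refine ⟨fun hu i => hu _ (Submodule.subset_span ⟨i, rfl⟩), fun hu y hy => ?_⟩
    refine Submodule.span_induction ?_ (by simp) ?_ ?_ hy
    · rintro _ ⟨i, rfl⟩; exact hu i
    · intro y z _ _ hy hz; rw [inner_add_right, hy, hz, add_zero]
    · intro r y _ hy; rw [inner_smul_right, hy, mul_zero]
  have hort : (Submodule.span ℝ (Set.range f))ᗮ = Submodule.span ℝ {v} := by
    ext u
    rw [hmem, Submodule.mem_span_singleton]
    constructor
    · intro hu
      refine ⟨inner ℝ v u, (sub_eq_zero.1 (h (u - inner ℝ v u • v) ?_ fun i => ?_)).symm⟩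
      · rw [inner_sub_right, inner_smul_right, real_inner_self_eq_norm_sq, hv]; ring
      · rw [inner_sub_left, real_inner_smul_left, hu, hvf]; ring
    · rintro ⟨a, rfl⟩ i
      rw [real_inner_smul_left, hvf, mul_zero]
  have h1 := (Submodule.span ℝ (Set.range f)).finrank_add_finrank_orthogonal
  rw [hort, finrank_span_singleton (by rw [← norm_ne_zero_iff, hv]; exact one_ne_zero),
    finrank_euclideanSpace_fin] at h1
  omega

/-- The classification of the surfaces for which `dN = -dF`, where `N` is not a multiple of `φ`. -/
theorem IsNormalField.typeIII_or_totallyGeodesic [ConnectedSpace S]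
    (hφ : IsConformalHarmonicImmersion φ) (hN : IsNormalField φ N) {v : E7} {β : ℝ}
    (hv : ‖v‖ = 1) (hvφ : ∀ p, inner ℝ v (φ p) = 0) (hvN : ∀ p, inner ℝ v (N p) = 0)
    (hvc : ∀ p, ∃ s : ℝ, s • v = crossL (φ p) (N p)) (hs : ∀ p, crossL (φ p) (N p) ≠ 0)
    (hNφ : ∀ p, N p = rotL v (-(3 * β)) (φ p)) :
    (∃ (v : E7) (β : ℝ) (φ' : S → E7), ‖v‖ = 1 ∧
      IsAlmostComplexCurveTypeIII (atlas ℂ S) φ' ∧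
      (∀ p, inner ℝ v (φ' p) = 0) ∧ ∀ p, φ p = rot7 v β (φ' p)) ∨
    IsTotallyGeodesicInSphere φ := by
  have hv0 : v ≠ 0 := by rw [← norm_ne_zero_iff, hv]; exact one_ne_zero
  have hud : ∀ u : E7, (∀ p, inner ℝ u (φ p) = 0) → ∀ e ∈ atlas ℂ S, ∀ z ∈ e.target, ∀ w,
      inner ℝ u (fderiv ℝ (φ ∘ e.symm) z w) = 0 := by
    intro u hu e he z hz w
    have h1 := inner_hasFDerivAt_eq_zero (hasFDerivAt_const u z)
      (hφ.immersion.1.hasFDerivAt_comp_symm he hz) (Eventually.of_forall fun w => hu (e.symm w)) w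
    simpa using h1
  have hvd := hud v hvφ
  have hort : ∀ e ∈ atlas ℂ S, ∀ z ∈ e.target, ∀ w,
      inner ℝ (φ (e.symm z)) (fderiv ℝ (φ ∘ e.symm) z w) = 0 := fun e he z hz w =>
    (hφ.isConformalHarmonicOn he).inner_fderiv hz w
  -- v is parallel to φ × N, and ⟨φ × N, φ × dφ⟩ = ⟨N, dφ⟩ - ⟨φ, N⟩⟨φ, dφ⟩ = 0.
  have hvcd : ∀ e ∈ atlas ℂ S, ∀ z ∈ e.target, ∀ w,
      inner ℝ v (crossL (φ (e.symm z)) (fderiv ℝ (φ ∘ e.symm) z w)) = 0 := by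
    intro e he z hz w
    obtain ⟨s, h1⟩ := hvc (e.symm z)
    have hs0 : s ≠ 0 := by
      rintro rfl
      exact hs _ (by rw [← h1, zero_smul])
    have h2 : s * inner ℝ v (crossL (φ (e.symm z)) (fderiv ℝ (φ ∘ e.symm) z w)) = 0 := by
      rw [← real_inner_smul_left, h1, inner_crossL_crossL, hN.inner_fderiv hφ he hz,
        hort e he z hz]
      ring
    exact (mul_eq_zero.1 h2).resolve_left hs0
  by_cases hu : ∃ u, u ≠ 0 ∧ inner ℝ v u = 0 ∧ ∀ p, inner ℝ u (φ p) = 0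
  · obtain ⟨u, hu0, hvu, huφ⟩ := hu
    right
    intro e he z hz a b
    have hg := hφ.isConformalHarmonicOn he
    have ht0 : crossL v u ≠ 0 := by
      rw [← norm_ne_zero_iff, norm_crossL_of_inner_eq_zero hvu, hv, one_mul]
      exact norm_ne_zero_iff.2 hu0
    exact hg.sphereSecondFF_eq_zero_of_mem_span ht0 (fun w hw =>
      hg.mem_span_of_orthogonal hw hv0 (hvφ _) (hvd e he w hw) (hvcd e he w hw)
        (by rw [hN e he w hw, inner_smul_right, hvN, mul_zero]) hvu (huφ _)
        (hud u huφ e he w hw)) hz a b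
  · left
    push Not at hu
    have hback : ∀ p, rotL v β (rotL v (-β) (φ p)) = φ p := by
      intro p
      rw [rotL_rotL hv _ _ (hvφ p), add_neg_cancel, rotL_zero (hvφ p)]
    have hd' : ∀ e ∈ atlas ℂ S, ∀ z ∈ e.target, ∀ w,
        fderiv ℝ ((fun p => rotL v (-β) (φ p)) ∘ e.symm) z w
          = rotL v (-β) (fderiv ℝ (φ ∘ e.symm) z w) := by
      intro e he z hz w
      have h1 := (rotL v (-β)).hasFDerivAt.comp z (hφ.immersion.1.hasFDerivAt_comp_symm he hz)
      exact DFunLike.congr_fun h1.fderiv w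
    refine ⟨v, β, fun p => rotL v (-β) (φ p), hv, ⟨⟨fun p => ?_, ?_, ?_, ?_⟩, ?_⟩,
      fun p => inner_rotL_right _ (hvφ p), fun p => ?_⟩
    · rw [mem_sphere_zero_iff_norm, norm_rotL hv _ (hvφ p)]
      simpa using hφ.mem_sphere p
    · exact (rotL v (-β)).contDiff.contMDiff.comp hφ.immersion.1
    · obtain ⟨p, q, hpq⟩ := hφ.nonconstant
      refine ⟨p, q, fun h => hpq ?_⟩
      rw [← hback p, h, hback]
    · intro e he z hz w
      have h1 := hN.crossL_fderiv hφ he hz w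
      -- Viewing dφ as rotated by angle 0, N × dφ = *dφ becomes R_v(3β)(φ × dφ) = *dφ. Both sides of
      -- the equation for R_v(-β) φ then equal R_v(2β)(φ × dφ), since 3β - β = β + β; this is why
      -- the angle is divided by three.
      rw [hNφ, ← rotL_zero (hvd e he z hz w), crossL_rotL_rotL hv _ _ (hvφ _) (hvd e he z hz w)
        (hort e he z hz w) (hvcd e he z hz w), add_zero, neg_neg] at h1
      rw [hd' e he z hz, hd' e he z hz, ← h1, ← crossL_apply,
        crossL_rotL_rotL hv _ _ (hvφ _) (hvd e he z hz w) (hort e he z hz w) (hvcd e he z hz w),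
        rotL_rotL hv _ _ (hvcd e he z hz w)]
      congr 2
      ring
    · refine finrank_span_eq_six hv (fun p => inner_rotL_right _ (hvφ p)) fun u hvu huf => ?_
      by_contra hu0
      obtain ⟨p, hp⟩ := hu (rotL v β u)
        (by rw [← norm_ne_zero_iff, norm_rotL hv _ hvu]; exact norm_ne_zero_iff.2 hu0)
        (inner_rotL_right _ hvu)
      refine hp ?_
      rw [← hback p, inner_rotL_rotL hv _ hvu (inner_rotL_right _ (hvφ p)), huf]
    · rw [← rotL_apply, hback]

end Surfaces

/-! ### The theorem. -/

theorem mainTheorem1 {S : Type*} [TopologicalSpace S] [T2Space S] [ConnectedSpace S]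
    [ChartedSpace ℂ S] [IsManifold 𝓘(ℂ, ℂ) ω S] (φ F : S → E7)
    (hφ : IsConformalHarmonicImmersion φ) (hF : IsAssociatedSurface φ F) :
    IsMinimalInSomeHypersphere F ↔
      ∃ A : Set (OpenPartialHomeomorph S ℂ), (A = atlas ℂ S ∨ A = conjAtlas S) ∧
        (IsAlmostComplexCurve A φ ∨
          (∃ (v : E7) (β : ℝ) (φ' : S → E7), ‖v‖ = 1 ∧ IsAlmostComplexCurveTypeIII A φ' ∧
            (∀ p, inner ℝ v (φ' p) = 0) ∧ ∀ p, φ p = rot7 v β (φ' p)) ∨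
          IsTotallyGeodesicInSphere φ) := by
  constructor
  · intro h
    obtain ⟨N, hN, hd⟩ := h.exists_isNormalField hφ hF
    obtain ⟨p₀⟩ : Nonempty S := inferInstance
    have hN1 := hN.norm_eq_one hφ
    have hφ1 : ∀ p, ‖φ p‖ = 1 := fun p => by simpa using hφ.mem_sphere p
    set α := inner ℝ (N p₀) (φ p₀) with hα
    have hαp : ∀ p, inner ℝ (N p) (φ p) = α := fun p => hN.inner_eq hφ hF hd p p₀
    have hαabs : |α| ≤ 1 := by
      have := abs_real_inner_le_norm (N p₀) (φ p₀)
      rwa [hN1, hφ1, one_mul] at this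
    by_cases h1 : α = 1
    · have hNφ : ∀ p, N p = φ p := fun p =>
        (inner_eq_one_iff_of_norm_eq_one (𝕜 := ℝ) (hN1 p) (hφ1 p)).1 ((hαp p).trans h1)
      refine ⟨_, Or.inl rfl, Or.inl ⟨hφ.mem_sphere, hφ.immersion.1, hφ.nonconstant, ?_⟩⟩
      intro e he z hz w
      rw [← hN.crossL_fderiv hφ he hz w, hNφ, crossL_apply]
    by_cases h2 : α = -1
    · have hNφ : ∀ p, N p = -φ p := fun p =>
        (inner_eq_one_iff_of_norm_eq_one (𝕜 := ℝ) (hN1 p) (by rw [norm_neg, hφ1])).1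
          (by rw [inner_neg_right, hαp, h2, neg_neg])
      refine ⟨_, Or.inr rfl, Or.inl ⟨hφ.mem_sphere, hφ.immersion.1, hφ.nonconstant, ?_⟩⟩
      rw [complexLinear_conjAtlas_iff]
      intro e he z hz w
      rw [← hN.crossL_fderiv hφ he hz w, hNφ, map_neg, neg_apply]
    refine ⟨_, Or.inl rfl, Or.inr ?_⟩
    have hlt : 0 < 1 - α ^ 2 := by
      have := (abs_le.1 hαabs)
      have h3 : 0 < 1 - α := sub_pos.2 (lt_of_le_of_ne this.2 h1)
      have h4 : 0 < 1 + α := by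
        have := lt_of_le_of_ne this.1 (Ne.symm h2)
        linarith
      nlinarith
    set s := √(1 - α ^ 2) with hs
    have hs0 : 0 < s := Real.sqrt_pos.2 hlt
    have hss : s ^ 2 = 1 - α ^ 2 := Real.sq_sqrt hlt.le
    -- The sign is chosen so that v × φ = s⁻¹(αφ - N), that is, N = αφ - s v × φ, the rotation of φ
    -- by -arccos α.
    set v : E7 := -s⁻¹ • crossL (φ p₀) (N p₀) with hv
    have hvc : ∀ p, (-s) • v = crossL (φ p) (N p) := by
      intro p
      rw [hv, smul_smul, hN.crossL_eq hφ hF hd p p₀, neg_mul_neg, mul_inv_cancel₀ hs0.ne', one_smul]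
    have hcs : ∀ p, ‖crossL (φ p) (N p)‖ = s := by
      intro p
      have h3 : ‖crossL (φ p) (N p)‖ ^ 2 = s ^ 2 := by
        rw [← real_inner_self_eq_norm_sq, inner_crossL_crossL, real_inner_comm (N p) (φ p), hαp,
          real_inner_self_eq_norm_sq, real_inner_self_eq_norm_sq, hN1, hφ1, hss]
        ring
      exact (pow_left_inj₀ (norm_nonneg _) hs0.le two_ne_zero).1 h3
    have hv1 : ‖v‖ = 1 := by
      rw [hv, norm_smul, hcs, norm_neg, norm_inv, Real.norm_of_nonneg hs0.le,
        inv_mul_cancel₀ hs0.ne']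
    have hvort : ∀ p y, inner ℝ (crossL (φ p) (N p)) y = 0 → inner ℝ v y = 0 := by
      intro p y h
      rw [← hvc p, real_inner_smul_left] at h
      exact (mul_eq_zero.1 h).resolve_left (neg_ne_zero.2 hs0.ne')
    have hvφ : ∀ p, inner ℝ v (φ p) = 0 := fun p =>
      hvort p _ (by rw [real_inner_comm, inner_crossL_self_left])
    refine hN.typeIII_or_totallyGeodesic hφ (v := v) (β := Real.arccos α / 3) hv1 hvφ
      (fun p => hvort p _ (by rw [real_inner_comm, inner_crossL_self_right]))
      (fun p => ⟨_, hvc p⟩) (fun p => by rw [← norm_ne_zero_iff, hcs]; exact hs0.ne')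
      (fun p => ?_)
    rw [mul_div_cancel₀ _ three_ne_zero, rotL_of_orthogonal _ (hvφ p), Real.cos_neg, Real.sin_neg,
      Real.cos_arccos (abs_le.1 hαabs).1 (abs_le.1 hαabs).2, Real.sin_arccos, ← hs]
    have h3 := crossL_crossL_self (φ p) (N p)
    rw [← hvc p, map_smul, crossL_swap, real_inner_comm, hαp, real_inner_self_eq_norm_sq, hφ1] at h3
    linear_combination (norm := module) h3
  · rintro ⟨A, hA, h | ⟨v, β, φ', hv, h, hvφ, hrot⟩ | h⟩
    · exact isMinimal_of_isAlmostComplexCurve hφ hF hA h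
    · exact isMinimal_of_eq_rot7 hφ hF hA hv h.1 hvφ hrot
    · exact isMinimal_of_isTotallyGeodesicInSphere hφ hF h
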